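/- Let $V$ be an infinite countable set and let $\mathcal G=(\mathcal E,V,m)$ be a weighted graph: $\mathcal E:V\times V\to[0,\infty)$ is symmetric, $m:V\to(0,\infty)$, there are no loops ($\mathcal E(x,x)=0$), every vertex has finitely many neighbours ($x\sim y$ means $\mathcal E(x,y)>0$), and the graph is connected. Let $\ell^2_{\rm anti}(\mathcal E)$ be the Hilbert space of antisymmetric functions $f(x,y)=-f(y,x)$ on the edges with $\|f\|^2=\frac12\sum_{x,y}\mathcal E(x,y)|f(x,y)|^2<\infty$, and let $\Delta_1=dd^*$ be the nonnegative symmetric operator $$\Delta_1 f(x,y)=\frac1{m(x)}\sum_{z}\mathcal E(x,z)f(x,z)+\frac1{m(y)}\sum_{z}\mathcal E(z,y)f(z,y)$$ on the finitely supported antisymmetric functions on the edges, where $df(x,y)=f(y)-f(x)$ and $d^*f(x)=\frac1{m(x)}\sum_y\mathcal E(y,x)f(y,x)$. Let $\Delta_1^{\mathcal F}$ be its Friedrichs extension. Then $$\inf\sigma(\Delta_1^{\mathcal F})\le\inf_{x\sim y}\Big(\frac1{m(x)}+\frac1{m(y)}\Big)\mathcal E(x,y)$$ and $$\inf\sigma_{\rm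 ess}(\Delta_1^{\mathcal F})\le\sup_{K\subset V\times V,\ K\text{ finite}}\ \inf_{x\sim y,\ (x,y)\notin K}\Big(\frac1{m(x)}+\frac1{m(y)}\Big)\mathcal E(x,y),$$ as inequalities in $[-\infty,+\infty]$, with $\inf\emptyset=+\infty$. In particular, if $\mathcal G$ is simple (that is, $m\equiv1$ and $\mathcal E$ takes values in $\{0,1\}$), then $\Delta_1^{\mathcal F}$ does not have compact resolvent. -/

import Mathlib

open scoped ComplexConjugate

/-- A weighted graph on the vertex set `V`: a symmetric edge weight `E : V × V → [0, ∞)` and a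
vertex weight `m : V → (0, ∞)`. The standing assumptions of the theory are part of the structure:
there are no loops, every vertex has finitely many neighbours, and the graph is connected. -/
structure WeightedGraph (V : Type*) where
  /-- the edge weight -/
  E : V → V → ℝ
  /-- the vertex weight -/
  m : V → ℝ
  E_nonneg : ∀ x y, 0 ≤ E x y
  E_symm : ∀ x y, E x y = E y x
  m_pos : ∀ x, 0 < m x
  no_loop : ∀ x, E x x = 0
  locally_finite : ∀ x, {y | 0 < E x y}.Finite
  connected : ∀ x y, Relation.ReflTransGen (fun a b => 0 < E a b) x y

/-! ### Unbounded operators: spectrum, essential spectrum, compact resolvent -/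

namespace UnboundedOperator

variable {H : Type*} [NormedAddCommGroup H] [InnerProductSpace ℂ H]

/-- The bounded everywhere defined operator `R` is the inverse of `A - z : D(A) → H`. -/
def IsResolventAt (A : H →ₗ.[ℂ] H) (z : ℂ) (R : H →L[ℂ] H) : Prop :=
  (∀ f : H, ∃ u : A.domain, (u : H) = R f ∧ A u - z • (u : H) = f) ∧
    ∀ u : A.domain, R (A u - z • (u : H)) = u

/-- The spectrum: all `z` for which `A - z` has no bounded everywhere defined inverse. -/
def spectrum (A : H →ₗ.[ℂ] H) : Set ℂ :=
  {z | ¬ ∃ R : H →L[ℂ] H, IsResolventAt A z R}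

/-- The kernel of `A - z`, as a subspace of the domain of `A`. -/
def eigenspace (A : H →ₗ.[ℂ] H) (z : ℂ) : Submodule ℂ A.domain :=
  LinearMap.ker (A.toFun - z • A.domain.subtype)

/-- The discrete spectrum: the isolated points of the spectrum that are eigenvalues of finite
multiplicity. -/
def discreteSpectrum (A : H →ₗ.[ℂ] H) : Set ℂ :=
  {z | z ∈ spectrum A ∧ (∃ ε : ℝ, 0 < ε ∧ ∀ w ∈ spectrum A, dist w z < ε → w = z) ∧
    eigenspace A z ≠ ⊥ ∧ FiniteDimensional ℂ (eigenspace A z)}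

/-- The essential spectrum (of a self-adjoint operator): the complement of the discrete spectrum
in the spectrum. -/
def essentialSpectrum (A : H →ₗ.[ℂ] H) : Set ℂ :=
  spectrum A \ discreteSpectrum A

/-- The infimum of the real points of a set of complex numbers, with value `+∞` if there is
none. -/
noncomputable def bottom (S : Set ℂ) : EReal :=
  ⨅ t : ℝ, ⨅ _ : (t : ℂ) ∈ S, (t : EReal)

/-- `A` has compact resolvent: `(A - z)⁻¹` is a compact operator for some `z` in the resolvent
set. -/
def HasCompactResolvent (A : H →ₗ.[ℂ] H) : Prop :=
  ∃ (z : ℂ) (R : H →L[ℂ] H), IsResolventAt A z R ∧ IsCompactOperator R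

/-! ### The Friedrichs extension -/

/-- Densely defined, symmetric and nonnegative operators. -/
structure IsNonnegSymmetric (T : H →ₗ.[ℂ] H) : Prop where
  dense : Dense (T.domain : Set H)
  symm : T.IsFormalAdjoint T
  nonneg : ∀ u : T.domain, 0 ≤ (inner ℂ (u : H) (T u)).re

/-- The quadratic form `u ↦ ⟨u, T u⟩` on `D(T)`. -/
noncomputable def quadForm (T : H →ₗ.[ℂ] H) (u : T.domain) : ℝ :=
  (inner ℂ (u : H) (T u)).re

theorem quadForm_add_le {T : H →ₗ.[ℂ] H} (hT : IsNonnegSymmetric T) (a b : T.domain) :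
    quadForm T (a + b) ≤ 2 * quadForm T a + 2 * quadForm T b := by
  have h : 0 ≤ quadForm T (a - b) := hT.nonneg (a - b)
  simp only [quadForm, LinearPMap.map_sub, LinearPMap.map_add, Submodule.coe_sub,
    Submodule.coe_add, inner_add_left, inner_add_right, inner_sub_left, inner_sub_right,
    Complex.add_re, Complex.sub_re] at h ⊢
  linarith

theorem quadForm_smul (T : H →ₗ.[ℂ] H) (c : ℂ) (a : T.domain) :
    quadForm T (c • a) = ‖c‖ ^ 2 * quadForm T a := by
  simp only [quadForm, LinearPMap.map_smul, Submodule.coe_smul, inner_smul_left,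
    inner_smul_right]
  rw [← mul_assoc, Complex.mul_conj, Complex.re_ofReal_mul, Complex.normSq_eq_norm_sq]

/-- The domain of the closure of the form `u ↦ ⟨u, T u⟩`: all limits in `H` of sequences in
`D(T)` that are Cauchy for the form. -/
def formDomain (T : H →ₗ.[ℂ] H) (hT : IsNonnegSymmetric T) : Submodule ℂ H where
  carrier := {u | ∃ v : ℕ → T.domain,
    Filter.Tendsto (fun n => (v n : H)) Filter.atTop (nhds u) ∧
    ∀ ε : ℝ, 0 < ε → ∃ N : ℕ, ∀ k ≥ N, ∀ l ≥ N, quadForm T (v k - v l) < ε}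
  zero_mem' := ⟨fun _ => 0, by simp, fun ε hε => ⟨0, fun k _ l _ => by simpa [quadForm] using hε⟩⟩
  add_mem' := by
    rintro a b ⟨v, hv, hv'⟩ ⟨w, hw, hw'⟩
    refine ⟨fun n => v n + w n, by simpa using hv.add hw, fun ε hε => ?_⟩
    obtain ⟨N, hN⟩ := hv' (ε / 4) (by positivity)
    obtain ⟨M, hM⟩ := hw' (ε / 4) (by positivity)
    refine ⟨max N M, fun k hk l hl => ?_⟩
    have h1 := hN k (le_trans (le_max_left _ _) hk) l (le_trans (le_max_left _ _) hl)
    have h2 := hM k (le_trans (le_max_right _ _) hk) l (le_trans (le_max_right _ _) hl)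
    have h3 := quadForm_add_le hT (v k - v l) (w k - w l)
    rw [show v k + w k - (v l + w l) = (v k - v l) + (w k - w l) by abel]
    linarith
  smul_mem' := by
    rintro c a ⟨v, hv, hv'⟩
    refine ⟨fun n => c • v n, by simpa using hv.const_smul c, fun ε hε => ?_⟩
    have hc : 0 < ‖c‖ ^ 2 + 1 := by positivity
    obtain ⟨N, hN⟩ := hv' (ε / (‖c‖ ^ 2 + 1)) (by positivity)
    refine ⟨N, fun k hk l hl => ?_⟩
    have h1 := hN k hk l hl
    have h0 : 0 ≤ quadForm T (v k - v l) := hT.nonneg _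
    rw [← smul_sub, quadForm_smul]
    rw [lt_div_iff₀ hc] at h1
    nlinarith

/-- The Friedrichs extension of a densely defined nonnegative symmetric operator `T`: the
restriction of `T*` to the vectors of `D(T*)` that lie in the domain of the closed form. -/
noncomputable def friedrichs [CompleteSpace H] (T : H →ₗ.[ℂ] H) (hT : IsNonnegSymmetric T) :
    H →ₗ.[ℂ] H :=
  T.adjoint.domRestrict (formDomain T hT)

end UnboundedOperator

namespace WeightedGraph

variable {V : Type*} (G : WeightedGraph V)

/-- The graph is simple: `m = 1` and `E` has values in `{0, 1}`. -/
def IsSimple : Prop :=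
  (∀ x, G.m x = 1) ∧ ∀ x y, G.E x y = 0 ∨ G.E x y = 1

/-! ### The Hilbert space of square summable antisymmetric `1`-forms -/

/-- Antisymmetric functions `f` on `V × V` with `∑ E(x,y) |f(x,y)|² < ∞`. Values at pairs that are
not edges play no role in this space; they are normalised to `0`. -/
def antiForms : Submodule ℂ (V → V → ℂ) where
  carrier := {f | (∀ x y, f x y = - f y x) ∧ (∀ x y, G.E x y = 0 → f x y = 0) ∧
    Summable fun p : V × V => G.E p.1 p.2 * ‖f p.1 p.2‖ ^ 2}
  zero_mem' := by simp [summable_zero]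
  add_mem' := by
    rintro f g ⟨hf1, hf2, hf3⟩ ⟨hg1, hg2, hg3⟩
    refine ⟨fun x y => ?_, fun x y h => ?_, ?_⟩
    · simp only [Pi.add_apply]
      rw [hf1 x y, hg1 x y]
      ring
    · simp [hf2 x y h, hg2 x y h]
    · refine Summable.of_nonneg_of_le
        (fun p => mul_nonneg (G.E_nonneg _ _) (sq_nonneg _)) (fun p => ?_)
        ((hf3.mul_left 2).add (hg3.mul_left 2))
      have h1 : ‖f p.1 p.2 + g p.1 p.2‖ ^ 2 ≤ 2 * ‖f p.1 p.2‖ ^ 2 + 2 * ‖g p.1 p.2‖ ^ 2 := by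
        have := norm_add_le (f p.1 p.2) (g p.1 p.2)
        nlinarith [sq_nonneg (‖f p.1 p.2‖ - ‖g p.1 p.2‖), norm_nonneg (f p.1 p.2 + g p.1 p.2)]
      have := mul_le_mul_of_nonneg_left h1 (G.E_nonneg p.1 p.2)
      simp only [Pi.add_apply]
      linarith
  smul_mem' := by
    rintro c f ⟨hf1, hf2, hf3⟩
    refine ⟨fun x y => ?_, fun x y h => ?_, ?_⟩
    · simp only [Pi.smul_apply, smul_eq_mul]
      rw [hf1 x y]
      ring
    · simp [hf2 x y h]
    · refine (hf3.mul_left (‖c‖ ^ 2)).congr fun p => ?_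
      simp only [Pi.smul_apply, smul_eq_mul, norm_mul]
      ring

/-- The space `ℓ²_anti(E)`. -/
def L2Anti : Type _ := G.antiForms

namespace L2Anti

variable {G}

noncomputable instance : AddCommGroup G.L2Anti := inferInstanceAs (AddCommGroup G.antiForms)

noncomputable instance : Module ℂ G.L2Anti := inferInstanceAs (Module ℂ G.antiForms)

instance : CoeFun G.L2Anti (fun _ => V → V → ℂ) := ⟨fun f => f.1⟩

@[simp] theorem add_apply (f g : G.L2Anti) (x y : V) : (f + g) x y = f x y + g x y := rfl

@[simp] theorem smul_apply (c : ℂ) (f : G.L2Anti) (x y : V) : (c • f) x y = c * f x y := rfl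

@[simp] theorem sub_apply (f g : G.L2Anti) (x y : V) : (f - g) x y = f x y - g x y := rfl

@[simp] theorem zero_apply (x y : V) : (0 : G.L2Anti) x y = 0 := rfl

theorem ext {f g : G.L2Anti} (h : ∀ x y, f x y = g x y) : f = g :=
  Subtype.ext (funext fun x => funext fun y => h x y)

theorem antisymm (f : G.L2Anti) (x y : V) : f x y = - f y x := f.2.1 x y

theorem eq_zero (f : G.L2Anti) {x y : V} (h : G.E x y = 0) : f x y = 0 := f.2.2.1 x y h

theorem summable_sq (f : G.L2Anti) :
    Summable fun p : V × V => G.E p.1 p.2 * ‖f p.1 p.2‖ ^ 2 := f.2.2.2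

theorem summable_inner (f g : G.L2Anti) :
    Summable fun p : V × V => (G.E p.1 p.2 : ℂ) * (conj (f p.1 p.2) * g p.1 p.2) := by
  refine Summable.of_norm_bounded (f.summable_sq.add g.summable_sq) (fun p => ?_)
  have hE := G.E_nonneg p.1 p.2
  rw [norm_mul, norm_mul, Complex.norm_real, Real.norm_of_nonneg hE, RCLike.norm_conj, ← mul_add]
  refine mul_le_mul_of_nonneg_left ?_ hE
  nlinarith [sq_nonneg (‖f p.1 p.2‖ - ‖g p.1 p.2‖), norm_nonneg (f p.1 p.2),
    norm_nonneg (g p.1 p.2), mul_nonneg (norm_nonneg (f p.1 p.2)) (norm_nonneg (g p.1 p.2))]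

/-- The scalar product `⟨f, g⟩ = 1/2 ∑_{x,y} E(x,y) conj(f(x,y)) g(x,y)`. -/
noncomputable instance : Inner ℂ G.L2Anti :=
  ⟨fun f g => 1 / 2 * ∑' p : V × V, (G.E p.1 p.2 : ℂ) * (conj (f p.1 p.2) * g p.1 p.2)⟩

theorem inner_def (f g : G.L2Anti) : inner ℂ f g =
    1 / 2 * ∑' p : V × V, (G.E p.1 p.2 : ℂ) * (conj (f p.1 p.2) * g p.1 p.2) := rfl

theorem inner_self_eq (f : G.L2Anti) : inner ℂ f f =
    ((1 / 2 * ∑' p : V × V, G.E p.1 p.2 * ‖f p.1 p.2‖ ^ 2 : ℝ) : ℂ) := by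
  rw [inner_def]
  push_cast
  congr 1
  refine tsum_congr fun p => ?_
  rw [← Complex.normSq_eq_conj_mul_self, Complex.normSq_eq_norm_sq]
  push_cast
  rfl

/-- The axioms of a scalar product. -/
noncomputable abbrev core : InnerProductSpace.Core ℂ G.L2Anti where
  inner f g := inner ℂ f g
  conj_inner_symm f g := by
    simp only [inner_def, map_mul, Complex.conj_tsum, map_div₀, map_one, map_ofNat,
      Complex.conj_conj, Complex.conj_ofReal]
    congr 1
    exact tsum_congr fun p => by ring
  re_inner_nonneg f := by
    rw [inner_self_eq]
    simp only [RCLike.re_to_complex, Complex.ofReal_re]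
    exact mul_nonneg (by norm_num)
      (tsum_nonneg fun p => mul_nonneg (G.E_nonneg _ _) (sq_nonneg _))
  add_left f g h := by
    simp only [inner_def]
    rw [← mul_add, ← (summable_inner f h).tsum_add (summable_inner g h)]
    congr 1
    refine tsum_congr fun p => ?_
    simp only [add_apply, map_add]
    ring
  smul_left f g c := by
    simp only [inner_def]
    rw [mul_left_comm]
    congr 1
    refine Eq.trans (tsum_congr fun p => ?_) tsum_mul_left
    simp only [smul_apply, map_mul]
    ring
  definite f h := by
    rw [inner_self_eq, Complex.ofReal_eq_zero] at h
    have h0 : ∑' p : V × V, G.E p.1 p.2 * ‖f p.1 p.2‖ ^ 2 = 0 := by linarith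
    have h3 := f.summable_sq.hasSum
    rw [h0] at h3
    have h4 : 0 ≤ fun p : V × V => G.E p.1 p.2 * ‖f p.1 p.2‖ ^ 2 := fun p =>
      mul_nonneg (G.E_nonneg p.1 p.2) (sq_nonneg ‖f p.1 p.2‖)
    have h1 := (hasSum_zero_iff_of_nonneg h4).1 h3
    refine ext fun x y => ?_
    have h2 := congrFun h1 (x, y)
    simp only [Pi.zero_apply, mul_eq_zero] at h2
    rcases h2 with h2 | h2
    · exact f.eq_zero h2
    · simpa using h2

noncomputable instance : NormedAddCommGroup G.L2Anti :=
  @InnerProductSpace.Core.toNormedAddCommGroup ℂ G.L2Anti _ _ _ core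

noncomputable instance : InnerProductSpace ℂ G.L2Anti := InnerProductSpace.ofCore core.toCore

theorem norm_sq_eq (f : G.L2Anti) :
    ‖f‖ ^ 2 = 1 / 2 * ∑' p : V × V, G.E p.1 p.2 * ‖f p.1 p.2‖ ^ 2 := by
  have h := inner_self_eq_norm_sq_to_K (𝕜 := ℂ) f
  rw [inner_self_eq] at h
  exact Complex.ofReal_injective (by rw [h]; norm_cast)

/-- The isometry `f ↦ (E/2)^{1/2} f` into the unweighted `ℓ²(V × V)`. -/
noncomputable def toLp : G.L2Anti →ₗᵢ[ℂ] lp (fun _ : V × V => ℂ) 2 where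
  toFun f := ⟨fun p => (Real.sqrt (G.E p.1 p.2 / 2) : ℂ) * f p.1 p.2, by
    refine memℓp_gen ((f.summable_sq.mul_left (1 / 2)).congr fun p => ?_)
    simp only [ENNReal.toReal_ofNat, Real.rpow_two, norm_mul, Complex.norm_real, mul_pow,
      Real.norm_eq_abs, sq_abs]
    rw [Real.sq_sqrt (div_nonneg (G.E_nonneg _ _) (by norm_num))]
    ring⟩
  map_add' f g := by
    ext p
    exact mul_add _ _ _
  map_smul' c f := by
    ext p
    simp only [smul_apply, RingHom.id_apply, lp.coeFn_smul, Pi.smul_apply, smul_eq_mul]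
    ring
  norm_map' f := by
    rw [← sq_eq_sq₀ (norm_nonneg _) (norm_nonneg _), norm_sq_eq]
    have h := lp.norm_rpow_eq_tsum (p := 2) (by norm_num) (E := fun _ : V × V => ℂ)
      ⟨fun p => (Real.sqrt (G.E p.1 p.2 / 2) : ℂ) * f p.1 p.2, by
        refine memℓp_gen ((f.summable_sq.mul_left (1 / 2)).congr fun p => ?_)
        simp only [ENNReal.toReal_ofNat, Real.rpow_two, norm_mul, Complex.norm_real, mul_pow,
          Real.norm_eq_abs, sq_abs]
        rw [Real.sq_sqrt (div_nonneg (G.E_nonneg _ _) (by norm_num))]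
        ring⟩
    simp only [ENNReal.toReal_ofNat, Real.rpow_two] at h
    refine h.trans ?_
    rw [← tsum_mul_left]
    refine tsum_congr fun p => ?_
    simp only [norm_mul, Complex.norm_real, mul_pow, Real.norm_eq_abs, sq_abs]
    rw [Real.sq_sqrt (div_nonneg (G.E_nonneg _ _) (by norm_num))]
    ring

theorem toLp_apply (f : G.L2Anti) (p : V × V) :
    toLp f p = (Real.sqrt (G.E p.1 p.2 / 2) : ℂ) * f p.1 p.2 := rfl

theorem range_toLp : Set.range (toLp (G := G)) =
    {g : lp (fun _ : V × V => ℂ) 2 | ∀ p : V × V,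
      g p = - g p.swap ∧ (G.E p.1 p.2 = 0 → g p = 0)} := by
  ext g
  constructor
  · rintro ⟨f, rfl⟩ p
    refine ⟨?_, fun h => ?_⟩
    · rw [toLp_apply, toLp_apply, Prod.fst_swap, Prod.snd_swap, f.antisymm, G.E_symm p.2 p.1]
      ring
    · rw [toLp_apply, f.eq_zero h, mul_zero]
  · intro hg
    have hs : ∀ x y, 0 < G.E x y → Real.sqrt (G.E x y / 2) ≠ 0 := fun x y h =>
      (Real.sqrt_pos.2 (by positivity)).ne'
    have hpos : ∀ x y, G.E x y ≠ 0 → 0 < G.E x y := fun x y h =>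
      lt_of_le_of_ne (G.E_nonneg x y) (Ne.symm h)
    refine ⟨⟨fun x y => (Real.sqrt (G.E x y / 2) : ℂ)⁻¹ * g (x, y), fun x y => ?_,
      fun x y h => ?_, ?_⟩, ?_⟩
    · have h := (hg (x, y)).1
      rw [Prod.swap_prod_mk] at h
      change (Real.sqrt (G.E x y / 2) : ℂ)⁻¹ * g (x, y) =
        -((Real.sqrt (G.E y x / 2) : ℂ)⁻¹ * g (y, x))
      rw [h, G.E_symm x y, mul_neg]
    · change (Real.sqrt (G.E x y / 2) : ℂ)⁻¹ * g (x, y) = 0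
      rw [(hg (x, y)).2 h, mul_zero]
    · have h := (memℓp_gen_iff (p := 2) (by norm_num)).1 (lp.memℓp g)
      simp only [ENNReal.toReal_ofNat, Real.rpow_two] at h
      refine (h.mul_left 2).congr fun p => ?_
      by_cases hp : G.E p.1 p.2 = 0
      · simp [hp, (hg p).2 hp]
      · have h2 : Real.sqrt (G.E p.1 p.2 / 2) ^ 2 = G.E p.1 p.2 / 2 :=
          Real.sq_sqrt (div_nonneg (G.E_nonneg _ _) (by norm_num))
        simp only [Prod.mk.eta, norm_mul, norm_inv, Complex.norm_real, mul_pow, inv_pow,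
          Real.norm_eq_abs, sq_abs]
        rw [h2]
        field_simp
    · ext p
      change (Real.sqrt (G.E p.1 p.2 / 2) : ℂ) * ((Real.sqrt (G.E p.1 p.2 / 2) : ℂ)⁻¹ * g p) = g p
      by_cases hp : G.E p.1 p.2 = 0
      · rw [(hg p).2 hp, mul_zero, mul_zero]
      · rw [mul_inv_cancel_left₀]
        exact_mod_cast hs _ _ (hpos _ _ hp)

instance : CompleteSpace G.L2Anti := by
  rw [completeSpace_iff_isComplete_range (toLp (G := G)).isometry.isUniformInducing, range_toLp]
  refine IsClosed.isComplete ?_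
  have hc : ∀ p : V × V, Continuous fun g : lp (fun _ : V × V => ℂ) 2 => g p := fun p =>
    (lp.evalCLM ℂ (fun _ : V × V => ℂ) 2 p).continuous
  have hrw : {g : lp (fun _ : V × V => ℂ) 2 | ∀ p : V × V,
      g p = - g p.swap ∧ (G.E p.1 p.2 = 0 → g p = 0)} =
      ⋂ p : V × V, {g | g p = - g p.swap} ∩ ⋂ _ : G.E p.1 p.2 = 0, {g | g p = 0} := by
    ext g
    simp
  rw [hrw]
  exact isClosed_iInter fun p => (isClosed_eq (hc p) (hc p.swap).neg).inter
    (isClosed_iInter fun _ => isClosed_eq (hc p) continuous_const)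

end L2Anti

/-! ### The Laplacian on `1`-forms -/

/-- The difference operator `d g (x,y) = g(y) - g(x)`. -/
def d (g : V → ℂ) : V → V → ℂ := fun x y => g y - g x

/-- The coboundary operator `d* f (x) = (1/m(x)) ∑_y E(y,x) f(y,x)`, a finite sum since `x` has
finitely many neighbours. -/
noncomputable def dStar (f : V → V → ℂ) : V → ℂ :=
  fun x => 1 / (G.m x : ℂ) * ∑ᶠ y, (G.E y x : ℂ) * f y x

open scoped Classical in
/-- The `1`-form `d (d* f)`, normalised to be `0` off the edges. -/
noncomputable def laplacianFun (f : V → V → ℂ) : V → V → ℂ :=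
  fun x y => if G.E x y = 0 then 0 else d (G.dStar f) x y

/-- The finitely supported antisymmetric forms `C^c_anti(E)`. -/
def finiteForms : Submodule ℂ G.L2Anti where
  carrier := {f | {p : V × V | f p.1 p.2 ≠ 0}.Finite}
  zero_mem' := by simp
  add_mem' := by
    intro f g hf hg
    refine (hf.union hg).subset fun p hp => ?_
    by_contra h
    simp only [Set.mem_union, Set.mem_ofPred_eq, not_or, not_not] at h
    exact hp (by rw [L2Anti.add_apply, h.1, h.2, add_zero])
  smul_mem' := by
    intro c f hf
    refine hf.subset fun p hp h => ?_
    exact hp (by rw [L2Anti.smul_apply, h, mul_zero])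

theorem dStar_eq_zero (f : V → V → ℂ) {x : V} (h : ∀ y, f y x = 0) : G.dStar f x = 0 := by
  simp [dStar, h]

theorem finite_support_term (f : V → V → ℂ) (x : V) :
    (Function.support fun y => (G.E y x : ℂ) * f y x).Finite := by
  refine (G.locally_finite x).subset fun y hy => ?_
  have h : G.E y x ≠ 0 := by
    intro h
    simp [h] at hy
  rw [G.E_symm] at h
  exact lt_of_le_of_ne (G.E_nonneg x y) (Ne.symm h)

theorem dStar_add (f g : V → V → ℂ) (x : V) :
    G.dStar (fun x y => f x y + g x y) x = G.dStar f x + G.dStar g x := by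
  simp only [dStar]
  rw [← mul_add, ← finsum_add_distrib (G.finite_support_term f x) (G.finite_support_term g x)]
  simp only [mul_add]

theorem dStar_smul (c : ℂ) (f : V → V → ℂ) (x : V) :
    G.dStar (fun x y => c * f x y) x = c * G.dStar f x := by
  simp only [dStar]
  rw [mul_left_comm]
  congr 1
  rw [mul_finsum]
  exact finsum_congr fun y => by ring

theorem finite_laplacianFun (f : V → V → ℂ) (hf : {p : V × V | f p.1 p.2 ≠ 0}.Finite) :
    {p : V × V | G.laplacianFun f p.1 p.2 ≠ 0}.Finite := by
  have hS : {x : V | G.dStar f x ≠ 0}.Finite := by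
    refine (hf.image Prod.snd).subset fun x hx => ?_
    by_contra h
    refine hx (G.dStar_eq_zero f fun y => ?_)
    by_contra h'
    exact h ⟨(y, x), h', rfl⟩
  have h1 : (⋃ x ∈ {x : V | G.dStar f x ≠ 0}, (fun y => (x, y)) '' {y | 0 < G.E x y}).Finite :=
    hS.biUnion fun x _ => (G.locally_finite x).image _
  refine (h1.union (h1.image Prod.swap)).subset ?_
  rintro ⟨x, y⟩ hp
  have hE : G.E x y ≠ 0 := by
    intro h
    simp [laplacianFun, h] at hp
  have hE1 : 0 < G.E x y := lt_of_le_of_ne (G.E_nonneg x y) (Ne.symm hE)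
  simp only [Set.mem_ofPred_eq, laplacianFun, if_neg hE, d] at hp
  by_cases hx : G.dStar f x = 0
  · have hy : G.dStar f y ≠ 0 := by
      intro hy
      simp [hx, hy] at hp
    right
    refine ⟨(y, x), ?_, rfl⟩
    simp only [Set.mem_iUnion]
    exact ⟨y, hy, x, by simpa [G.E_symm y x] using hE1, rfl⟩
  · left
    simp only [Set.mem_iUnion]
    exact ⟨x, hx, y, hE1, rfl⟩

theorem laplacianFun_mem (f : G.finiteForms) :
    G.laplacianFun (f : G.L2Anti) ∈ G.antiForms := by
  refine ⟨fun x y => ?_, fun x y h => by simp [laplacianFun, h], ?_⟩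
  · simp only [laplacianFun, G.E_symm y x, d]
    split_ifs <;> ring
  · refine summable_of_hasFiniteSupport ((G.finite_laplacianFun _ f.2).subset fun p hp h => ?_)
    simp [h] at hp

/-- The Laplacian on `1`-forms `Δ₁ = d d*` on the finitely supported antisymmetric forms. -/
noncomputable def laplacian : G.L2Anti →ₗ.[ℂ] G.L2Anti where
  domain := G.finiteForms
  toFun :=
    { toFun := fun f => ⟨G.laplacianFun (f : G.L2Anti), G.laplacianFun_mem f⟩
      map_add' := by
        intro f g
        refine L2Anti.ext fun x y => ?_
        change G.laplacianFun (fun x y => (f : G.L2Anti) x y + (g : G.L2Anti) x y) x y =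
          G.laplacianFun (f : G.L2Anti) x y + G.laplacianFun (g : G.L2Anti) x y
        simp only [laplacianFun, d, dStar_add]
        split_ifs <;> ring
      map_smul' := by
        intro c f
        refine L2Anti.ext fun x y => ?_
        change G.laplacianFun (fun x y => c * (f : G.L2Anti) x y) x y =
          c * G.laplacianFun (f : G.L2Anti) x y
        simp only [laplacianFun, d, dStar_smul]
        split_ifs <;> ring }

theorem laplacian_apply (f : G.laplacian.domain) (x y : V) (h : G.E x y ≠ 0) :
    G.laplacian f x y = G.dStar (f : G.L2Anti) y - G.dStar (f : G.L2Anti) x := by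
  change G.laplacianFun (f : G.L2Anti) x y = _
  simp [laplacianFun, h, d]

/-- `⟨f, w⟩ = ∑_x m(x) conj(d* f (x)) h(x)` for finitely supported `f` and `w = d h` on edges. -/
theorem inner_eq_sum (f : G.finiteForms) (w : G.L2Anti) (h : V → ℂ)
    (hw : ∀ x y, G.E x y ≠ 0 → w x y = h y - h x) (S : Finset V)
    (hS : ∀ x y, (f : G.L2Anti) x y ≠ 0 → x ∈ S ∧ y ∈ S) :
    inner ℂ (f : G.L2Anti) w =
      ∑ x ∈ S, (G.m x : ℂ) * (conj (G.dStar (f : G.L2Anti) x) * h x) := by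
  have h1 : ∑' p : V × V, (G.E p.1 p.2 : ℂ) * (conj ((f : G.L2Anti) p.1 p.2) * w p.1 p.2) =
      ∑ x ∈ S, ∑ y ∈ S, (G.E x y : ℂ) * (conj ((f : G.L2Anti) x y) * (h y - h x)) := by
    rw [tsum_eq_sum (s := S ×ˢ S), Finset.sum_product]
    · refine Finset.sum_congr rfl fun x _ => Finset.sum_congr rfl fun y _ => ?_
      by_cases hE : G.E x y = 0
      · simp [hE]
      · simp only [hw x y hE]
    · intro p hp
      have : (f : G.L2Anti) p.1 p.2 = 0 := by
        by_contra hne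
        exact hp (Finset.mem_product.2 (hS _ _ hne))
      simp [this]
  have h2 : ∑ x ∈ S, ∑ y ∈ S, (G.E x y : ℂ) * (conj ((f : G.L2Anti) x y) * h x) =
      - ∑ x ∈ S, ∑ y ∈ S, (G.E x y : ℂ) * (conj ((f : G.L2Anti) x y) * h y) := by
    rw [Finset.sum_comm, ← Finset.sum_neg_distrib]
    refine Finset.sum_congr rfl fun x _ => ?_
    rw [← Finset.sum_neg_distrib]
    refine Finset.sum_congr rfl fun y _ => ?_
    rw [L2Anti.antisymm _ y x, G.E_symm y x, map_neg]
    ring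
  have h3 : ∑ x ∈ S, (G.m x : ℂ) * (conj (G.dStar (f : G.L2Anti) x) * h x) =
      ∑ x ∈ S, ∑ y ∈ S, (G.E x y : ℂ) * (conj ((f : G.L2Anti) x y) * h y) := by
    rw [Finset.sum_comm]
    refine Finset.sum_congr rfl fun x _ => ?_
    have hm : (G.m x : ℂ) ≠ 0 := by exact_mod_cast (G.m_pos x).ne'
    have h4 : ∑ᶠ y, (G.E y x : ℂ) * (f : G.L2Anti) y x =
        ∑ y ∈ S, (G.E y x : ℂ) * (f : G.L2Anti) y x := by
      refine finsum_eq_sum_of_support_subset _ fun y hy => ?_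
      refine (hS y x fun hne => ?_).1
      simp [hne] at hy
    simp only [dStar]
    rw [h4]
    simp only [map_mul, map_div₀, map_one, map_sum, Complex.conj_ofReal]
    rw [mul_assoc, ← mul_assoc (G.m x : ℂ), mul_one_div_cancel hm, one_mul, Finset.sum_mul]
    exact Finset.sum_congr rfl fun y _ => by ring
  rw [L2Anti.inner_def, h1, h3]
  simp only [mul_sub, Finset.sum_sub_distrib]
  rw [h2]
  ring

open scoped Classical in
/-- A finite set of vertices carrying a finitely supported form. -/
theorem exists_support (f : G.finiteForms) :
    ∃ S : Finset V, ∀ x y, (f : G.L2Anti) x y ≠ 0 → x ∈ S ∧ y ∈ S := by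
  have hf : {p : V × V | (f : G.L2Anti) p.1 p.2 ≠ 0}.Finite := f.2
  refine ⟨hf.toFinset.image Prod.fst ∪ hf.toFinset.image Prod.snd, fun x y h => ⟨?_, ?_⟩⟩
  · exact Finset.mem_union_left _ (Finset.mem_image.2 ⟨(x, y), by simpa using h, rfl⟩)
  · exact Finset.mem_union_right _ (Finset.mem_image.2 ⟨(x, y), by simpa using h, rfl⟩)

open scoped Classical in
/-- `⟨f, Δ₁ g⟩ = ⟨d* f, d* g⟩`. -/
theorem inner_laplacian (f g : G.laplacian.domain) : ∃ S : Finset V,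
    inner ℂ (f : G.L2Anti) (G.laplacian g) =
      ∑ x ∈ S, (G.m x : ℂ) * (conj (G.dStar (f : G.L2Anti) x) * G.dStar (g : G.L2Anti) x) ∧
    inner ℂ (g : G.L2Anti) (G.laplacian f) =
      ∑ x ∈ S, (G.m x : ℂ) * (conj (G.dStar (g : G.L2Anti) x) * G.dStar (f : G.L2Anti) x) := by
  obtain ⟨S, hS⟩ := G.exists_support f
  obtain ⟨T, hT⟩ := G.exists_support g
  refine ⟨S ∪ T, G.inner_eq_sum f _ _ (G.laplacian_apply g) _ fun x y h => ?_,
    G.inner_eq_sum g _ _ (G.laplacian_apply f) _ fun x y h => ?_⟩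
  · exact ⟨Finset.mem_union_left _ (hS x y h).1, Finset.mem_union_left _ (hS x y h).2⟩
  · exact ⟨Finset.mem_union_right _ (hT x y h).1, Finset.mem_union_right _ (hT x y h).2⟩

open scoped Classical in
/-- The antisymmetric form `δ_{(a,b)} - δ_{(b,a)}` of an edge `(a,b)`. -/
noncomputable def edgeForm (a b : V) (hab : G.E a b ≠ 0) : G.finiteForms :=
  have hfin : {p : V × V | ((if p = (a, b) then 1 else 0) - (if p = (b, a) then 1 else 0) : ℂ)
      ≠ 0}.Finite := by
    refine (Set.toFinite {(a, b), (b, a)}).subset fun p hp => ?_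
    by_contra h
    simp only [Set.mem_insert_iff, Set.mem_singleton_iff, not_or] at h
    simp [h.1, h.2] at hp
  ⟨⟨fun x y => (if (x, y) = (a, b) then 1 else 0) - (if (x, y) = (b, a) then 1 else 0),
    fun x y => by
      simp only [Prod.mk.injEq, and_comm (a := y = _)]
      ring,
    fun x y h => by
      have h1 : (x, y) ≠ (a, b) := by
        rintro ⟨⟩
        exact hab h
      have h2 : (x, y) ≠ (b, a) := by
        rintro ⟨⟩
        exact hab (G.E_symm _ _ ▸ h)
      simp [h1, h2],
    summable_of_hasFiniteSupport (hfin.subset fun p hp h => by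
      simp only [Prod.mk.eta] at hp
      simp [h] at hp)⟩, hfin⟩

theorem dense_finiteForms : Dense (G.finiteForms : Set G.L2Anti) := by
  classical
  rw [Submodule.dense_iff_topologicalClosure_eq_top,
    Submodule.topologicalClosure_eq_top_iff, Submodule.eq_bot_iff]
  intro w hw
  refine L2Anti.ext fun a b => ?_
  by_cases hab : G.E a b = 0
  · rw [w.eq_zero hab]
    rfl
  have hne : a ≠ b := by
    rintro rfl
    exact hab (G.no_loop a)
  have h := (Submodule.mem_orthogonal _ _).1 hw _ (G.edgeForm a b hab).2
  rw [L2Anti.inner_def, tsum_eq_sum (s := {(a, b), (b, a)}),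
    Finset.sum_pair (by simp [hne])] at h
  · simp only [edgeForm, Prod.mk.injEq, hne, hne.symm, and_self, if_true, if_false, sub_zero,
      zero_sub, map_one, map_neg] at h
    rw [w.antisymm b a, G.E_symm b a] at h
    have h' : (G.E a b : ℂ) * w a b = 0 := by linear_combination h
    rcases mul_eq_zero.1 h' with h' | h'
    · exact absurd (by exact_mod_cast h') hab
    · simpa using h'
  · intro p hp
    simp only [Finset.mem_insert, Finset.mem_singleton, not_or] at hp
    have h0 : (G.edgeForm a b hab : G.L2Anti) p.1 p.2 = 0 := by
      change ((if p = (a, b) then 1 else 0) - (if p = (b, a) then 1 else 0) : ℂ) = 0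
      simp [hp.1, hp.2]
    simp [h0]

theorem laplacian_isNonnegSymmetric : UnboundedOperator.IsNonnegSymmetric G.laplacian where
  dense := G.dense_finiteForms
  symm f g := by
    obtain ⟨S, h1, h2⟩ := G.inner_laplacian f g
    rw [h1, ← inner_conj_symm, h2, map_sum]
    refine Finset.sum_congr rfl fun x _ => ?_
    simp only [map_mul, Complex.conj_conj, Complex.conj_ofReal]
    ring
  nonneg f := by
    obtain ⟨S, h1, -⟩ := G.inner_laplacian f f
    rw [h1, Complex.re_sum]
    refine Finset.sum_nonneg fun x _ => ?_
    rw [← Complex.normSq_eq_conj_mul_self, ← Complex.ofReal_mul, Complex.ofReal_re]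
    exact mul_nonneg (G.m_pos x).le (Complex.normSq_nonneg _)

/-- The Friedrichs extension `Δ₁^F` of `Δ₁`. An operator and its closure have the same adjoint and
the same closed form, hence the same Friedrichs extension. -/
noncomputable def friedrichsLaplacian : G.L2Anti →ₗ.[ℂ] G.L2Anti :=
  UnboundedOperator.friedrichs G.laplacian G.laplacian_isNonnegSymmetric

/-- The quantity `(1/m(x) + 1/m(y)) E(x,y)`. -/
noncomputable def edgePotential (x y : V) : ℝ :=
  (1 / G.m x + 1 / G.m y) * G.E x y

end WeightedGraph

/-! The bounds come from testing the form `⟨f, Δ₁ f⟩ = ‖d* f‖²` on the form of a single edge. That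
form has squared norm `E(a,b)`, and its `d*` lives at `a` and `b` with values `∓E(a,b)/m`, so its
Rayleigh quotient is exactly `(1/m(a) + 1/m(b)) E(a,b)` (`quadForm_edgeForm`). Edges without a
common vertex give forms orthogonal both in the Hilbert space and for the quadratic form. By local
finiteness, a property of edges that survives the removal of every finite set holds on a whole
sequence of such edges.

The passage from Rayleigh quotients to spectrum goes through the bounded self-adjoint operator `R =
(A + 1)⁻¹`, where `A` is the Friedrichs extension. If `j` is the map from the completed form space
to `H`, then `R = j j*`, and Cauchy–Schwarz turns a quotient `≤ μ` into `⟨R v, v⟩ ≥ ‖v‖² / (1 + μ)`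
(`exists_resolvent_friedrichs`, `norm_sq_le_resolvent`). The map `s ↦ 1/s - 1` carries the positive
spectrum of `R` into that of `A`. One test vector then forces spectrum. If all spectrum of `A` in
`(-∞, l]` were discrete, `R` would exceed `1 / (1 + l)` only on finitely many finite-dimensional
eigenspaces, and a combination of infinitely many decoupled test vectors avoids them all. On the
same normalised vectors a compact `R` would have diagonal entries with a subsequence tending to `0`.
-/

namespace UnboundedOperator

variable {H : Type*} [NormedAddCommGroup H] [InnerProductSpace ℂ H]

/-! ### The form space and the resolvent of the Friedrichs extension -/

/-- The domain of `T`, to be equipped with the form scalar product `⟨u, T v⟩ + ⟨u, v⟩`. -/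
def FormSpace (T : H →ₗ.[ℂ] H) (_ : IsNonnegSymmetric T) : Type _ := T.domain

namespace FormSpace

variable {T : H →ₗ.[ℂ] H} {hT : IsNonnegSymmetric T}

noncomputable instance : AddCommGroup (FormSpace T hT) := inferInstanceAs (AddCommGroup T.domain)

noncomputable instance : Module ℂ (FormSpace T hT) := inferInstanceAs (Module ℂ T.domain)

/-- A vector of the domain of `T`, seen in the form space. -/
def of (hT : IsNonnegSymmetric T) : T.domain ≃ₗ[ℂ] FormSpace T hT := LinearEquiv.refl ℂ T.domain

noncomputable instance : Inner ℂ (FormSpace T hT) :=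
  ⟨fun u v => inner ℂ ((of hT).symm u : H) (T ((of hT).symm v)) +
    inner ℂ ((of hT).symm u : H) ((of hT).symm v : H)⟩

theorem inner_def (u v : FormSpace T hT) :
    inner ℂ u v = inner ℂ ((of hT).symm u : H) (T ((of hT).symm v)) +
      inner ℂ ((of hT).symm u : H) ((of hT).symm v : H) := rfl

theorem re_inner_self (u : FormSpace T hT) :
    (inner ℂ u u).re = quadForm T ((of hT).symm u) + ‖((of hT).symm u : H)‖ ^ 2 := by
  rw [inner_def, Complex.add_re, quadForm]
  congr 1
  exact inner_self_eq_norm_sq (𝕜 := ℂ) _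

/-- The axioms of a scalar product. -/
noncomputable abbrev core : InnerProductSpace.Core ℂ (FormSpace T hT) where
  inner u v := inner ℂ u v
  conj_inner_symm u v := by
    simp only [inner_def, map_add, inner_conj_symm]
    rw [hT.symm]
  re_inner_nonneg u := by
    rw [RCLike.re_to_complex, re_inner_self]
    exact add_nonneg (hT.nonneg _) (sq_nonneg _)
  add_left u v w := by
    simp only [inner_def, map_add, Submodule.coe_add, inner_add_left]
    ring
  smul_left u v c := by
    simp only [inner_def, map_smul, Submodule.coe_smul, inner_smul_left]
    ring
  definite u h := by
    have h1 := re_inner_self u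
    rw [h, Complex.zero_re] at h1
    have h2 : 0 ≤ quadForm T ((of hT).symm u) := hT.nonneg _
    have h3 : ‖((of hT).symm u : H)‖ ^ 2 = 0 := by nlinarith [sq_nonneg ‖((of hT).symm u : H)‖]
    have h4 : (of hT).symm u = 0 := by simpa using h3
    simpa using h4

noncomputable instance : NormedAddCommGroup (FormSpace T hT) :=
  @InnerProductSpace.Core.toNormedAddCommGroup ℂ (FormSpace T hT) _ _ _ core

noncomputable instance : InnerProductSpace ℂ (FormSpace T hT) :=
  InnerProductSpace.ofCore core.toCore

theorem norm_sq_eq (u : FormSpace T hT) :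
    ‖u‖ ^ 2 = quadForm T ((of hT).symm u) + ‖((of hT).symm u : H)‖ ^ 2 := by
  rw [← re_inner_self]
  exact (inner_self_eq_norm_sq (𝕜 := ℂ) u).symm

/-- The inclusion of the form space into the Hilbert space. -/
noncomputable def incl (T : H →ₗ.[ℂ] H) (hT : IsNonnegSymmetric T) : FormSpace T hT →L[ℂ] H :=
  LinearMap.mkContinuous (T.domain.subtype ∘ₗ (of hT).symm.toLinearMap) 1 fun u => by
    rw [one_mul, ← sq_le_sq₀ (norm_nonneg _) (norm_nonneg _), norm_sq_eq]
    exact le_add_of_nonneg_left (hT.nonneg _)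

variable [CompleteSpace H]

/-- The extension of the inclusion to the completion of the form space. -/
noncomputable def extIncl (T : H →ₗ.[ℂ] H) (hT : IsNonnegSymmetric T) :
    UniformSpace.Completion (FormSpace T hT) →L[ℂ] H :=
  (incl T hT).extend (UniformSpace.Completion.toComplL (𝕜 := ℂ) (E := FormSpace T hT))

theorem extIncl_coe (u : FormSpace T hT) :
    extIncl T hT (u : UniformSpace.Completion (FormSpace T hT)) = ((of hT).symm u : H) :=
  ContinuousLinearMap.extend_eq (incl T hT) UniformSpace.Completion.denseRange_coe
    (UniformSpace.Completion.isUniformInducing_coe _) u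

/-- For `w` in the form space this is the definition of its scalar product, and both sides are
continuous in `w`. It makes the adjoint of `extIncl` a weak inverse of `T + 1`. -/
theorem inner_extIncl (w : UniformSpace.Completion (FormSpace T hT)) (v : T.domain) :
    inner ℂ (extIncl T hT w) (T v + v) =
      inner ℂ w (of hT v : UniformSpace.Completion (FormSpace T hT)) := by
  induction w using UniformSpace.Completion.induction_on with
  | hp => exact isClosed_eq (by fun_prop) (by fun_prop)
  | ih w =>
    rw [extIncl_coe, UniformSpace.Completion.inner_coe, inner_def, inner_add_right,
      LinearEquiv.symm_apply_apply]

/-- With `exists_extIncl_eq`, the form domain is the range of `extIncl`: the sequences defining it,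
convergent in `H` and Cauchy for `quadForm`, are the Cauchy sequences of the form norm. -/
theorem extIncl_mem_formDomain (w : UniformSpace.Completion (FormSpace T hT)) :
    extIncl T hT w ∈ formDomain T hT := by
  have hw : w ∈ closure (Set.range ((↑) : FormSpace T hT → _)) :=
    UniformSpace.Completion.denseRange_coe w
  obtain ⟨x, hx, hlim⟩ := mem_closure_iff_seq_limit.1 hw
  choose v hv using hx
  refine ⟨fun n => (of hT).symm (v n), ?_, fun ε hε => ?_⟩
  · refine (((extIncl T hT).continuous.tendsto w).comp hlim).congr fun n => ?_
    rw [Function.comp_apply, ← hv n, extIncl_coe]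
  · have hc := Metric.cauchySeq_iff.1 hlim.cauchySeq (Real.sqrt ε) (Real.sqrt_pos.2 hε)
    obtain ⟨N, hN⟩ := hc
    refine ⟨N, fun k hk l hl => ?_⟩
    have h := hN k hk l hl
    rw [← hv k, ← hv l, UniformSpace.Completion.dist_eq, dist_eq_norm,
      Real.lt_sqrt (norm_nonneg _), norm_sq_eq, map_sub] at h
    exact lt_of_le_of_lt (le_add_of_nonneg_right (sq_nonneg _)) h

theorem exists_extIncl_eq {u : H} (hu : u ∈ formDomain T hT) : ∃ w, extIncl T hT w = u := by
  obtain ⟨v, hv, hv'⟩ := hu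
  have hc : CauchySeq fun n => (of hT (v n) : UniformSpace.Completion (FormSpace T hT)) := by
    refine Metric.cauchySeq_iff.2 fun ε hε => ?_
    -- The squared form norm is `quadForm` plus the squared norm, so it ends up below `ε²/2 + ε²/4 <
    -- ε²`.
    obtain ⟨N, hN⟩ := hv' (ε ^ 2 / 2) (by positivity)
    obtain ⟨M, hM⟩ := Metric.cauchySeq_iff.1 hv.cauchySeq (ε / 2) (by positivity)
    refine ⟨max N M, fun k hk l hl => ?_⟩
    have h1 := hN k (le_trans (le_max_left _ _) hk) l (le_trans (le_max_left _ _) hl)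
    have h2 := hM k (le_trans (le_max_right _ _) hk) l (le_trans (le_max_right _ _) hl)
    rw [dist_eq_norm] at h2
    rw [UniformSpace.Completion.dist_eq, dist_eq_norm, ← sq_lt_sq₀ (norm_nonneg _) hε.le,
      norm_sq_eq, ← map_sub, LinearEquiv.symm_apply_apply, Submodule.coe_sub]
    nlinarith [norm_nonneg ((v k : H) - v l)]
  obtain ⟨w, hw⟩ := cauchySeq_tendsto_of_complete hc
  refine ⟨w, tendsto_nhds_unique (((extIncl T hT).continuous.tendsto w).comp hw)
    (hv.congr fun n => ?_)⟩
  rw [Function.comp_apply, extIncl_coe, LinearEquiv.symm_apply_apply]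

end FormSpace

variable [CompleteSpace H]

/-- The Friedrichs extension maps `u` to `f` if and only if `u` lies in the form domain and
`⟨f, v⟩ = ⟨u, T v⟩` on the domain of `T`. -/
theorem friedrichs_apply_eq_iff {T : H →ₗ.[ℂ] H} {hT : IsNonnegSymmetric T} {u f : H} :
    (∃ w : (friedrichs T hT).domain, (w : H) = u ∧ friedrichs T hT w = f) ↔
      u ∈ formDomain T hT ∧ ∀ v : T.domain, inner ℂ f (v : H) = inner ℂ u (T v) := by
  constructor
  · rintro ⟨w, rfl, rfl⟩
    have hw : (w : H) ∈ T.adjoint.domain := w.2.2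
    have h1 : friedrichs T hT w = T.adjoint ⟨w, hw⟩ := LinearPMap.domRestrict_apply rfl
    refine ⟨w.2.1, fun v => ?_⟩
    rw [h1]
    exact LinearPMap.adjoint_isFormalAdjoint hT.dense ⟨w, hw⟩ v
  · rintro ⟨hu, hf⟩
    have hw : u ∈ T.adjoint.domain := LinearPMap.mem_adjoint_domain_of_exists _ ⟨f, hf⟩
    refine ⟨⟨u, hu, hw⟩, rfl, ?_⟩
    have h1 : friedrichs T hT ⟨u, hu, hw⟩ = T.adjoint ⟨u, hw⟩ := LinearPMap.domRestrict_apply rfl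
    rw [h1]
    exact LinearPMap.adjoint_apply_eq hT.dense _ hf

/-- `-1` is in the resolvent set of the Friedrichs extension; its resolvent `R` there is
self-adjoint, and `⟨u, R u⟩` is bounded below in terms of the form. -/
theorem exists_resolvent_friedrichs (T : H →ₗ.[ℂ] H) (hT : IsNonnegSymmetric T) :
    ∃ R : H →L[ℂ] H, IsResolventAt (friedrichs T hT) (-1) R ∧ IsSelfAdjoint R ∧
      ∀ u : T.domain,
        ‖(u : H)‖ ^ 4 ≤ (inner ℂ (R u) (u : H)).re * (quadForm T u + ‖(u : H)‖ ^ 2) := by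
  set j := FormSpace.extIncl T hT with hj
  have hR : ∀ (f : H) (v : T.domain),
      inner ℂ (j (j.adjoint f)) (T v + v) = inner ℂ f (v : H) := fun f v => by
    rw [FormSpace.inner_extIncl, ContinuousLinearMap.adjoint_inner_left, FormSpace.extIncl_coe,
      LinearEquiv.symm_apply_apply]
  -- By `hR`, `u = j j* f` solves `(T + 1)* u = f`, and it lies in the form domain as a value of
  -- `j`; these two facts characterise `(A + 1) u = f`.
  refine ⟨j ∘L j.adjoint, ⟨fun f => ?_, fun u => ?_⟩, ?_, fun u => ?_⟩
  · obtain ⟨w, hw, hw'⟩ := (friedrichs_apply_eq_iff (hT := hT) (u := j (j.adjoint f))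
      (f := f - j (j.adjoint f))).2 ⟨FormSpace.extIncl_mem_formDomain _, fun v => by
        have h := hR f v
        rw [inner_add_right] at h
        rw [inner_sub_left, ← h]
        ring⟩
    refine ⟨w, hw, ?_⟩
    rw [hw, hw', neg_smul, one_smul]
    abel
  · obtain ⟨hu, hu'⟩ := (friedrichs_apply_eq_iff (hT := hT)).1 ⟨u, rfl, rfl⟩
    rw [neg_smul, one_smul, sub_neg_eq_add]
    obtain ⟨x, hx⟩ := FormSpace.exists_extIncl_eq hu
    suffices h : j.adjoint (friedrichs T hT u + u) = x by
      rw [ContinuousLinearMap.comp_apply, h, hj, hx]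
    -- Testing against the dense image of the domain of `T` avoids any appeal to injectivity of `j`.
    refine UniformSpace.Completion.denseRange_coe.eq_of_inner_left ℂ fun i => ?_
    obtain ⟨v, rfl⟩ := (FormSpace.of hT).surjective i
    rw [ContinuousLinearMap.adjoint_inner_left, hj, FormSpace.extIncl_coe,
      LinearEquiv.symm_apply_apply, ← FormSpace.inner_extIncl, hx, inner_add_left,
      inner_add_right, hu']
  · rw [ContinuousLinearMap.isSelfAdjoint_iff', ContinuousLinearMap.adjoint_comp,
      ContinuousLinearMap.adjoint_adjoint]
  · set x : UniformSpace.Completion (FormSpace T hT) := ((FormSpace.of hT u : FormSpace T hT) :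
      UniformSpace.Completion (FormSpace T hT)) with hx
    have hjx : j x = u := by
      rw [hj, hx, FormSpace.extIncl_coe, LinearEquiv.symm_apply_apply]
    have h1 : ‖x‖ ^ 2 = quadForm T u + ‖(u : H)‖ ^ 2 := by
      rw [hx, UniformSpace.Completion.norm_coe, FormSpace.norm_sq_eq,
        LinearEquiv.symm_apply_apply]
    have h2 : (inner ℂ ((j ∘L j.adjoint) (u : H)) (u : H)).re = ‖j.adjoint (u : H)‖ ^ 2 := by
      rw [ContinuousLinearMap.comp_apply, ← ContinuousLinearMap.adjoint_inner_right]
      exact inner_self_eq_norm_sq (𝕜 := ℂ) _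
    -- With `x` the image of `u` in the completion, `‖u‖² = ⟨j* u, x⟩`; Cauchy–Schwarz, squared,
    -- gives the bound, since `‖j* u‖² = ⟨R u, u⟩`.
    have h3 : ‖(u : H)‖ ^ 2 = ‖inner ℂ (j.adjoint (u : H)) x‖ := by
      rw [ContinuousLinearMap.adjoint_inner_left, hjx, inner_self_eq_norm_sq_to_K]
      simp
    have h4 := norm_inner_le_norm (𝕜 := ℂ) (j.adjoint (u : H)) x
    rw [h2, ← h1, ← mul_pow, show ‖(u : H)‖ ^ 4 = (‖(u : H)‖ ^ 2) ^ 2 by ring, h3]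
    gcongr

end UnboundedOperator

namespace UnboundedOperator

section Resolvent

variable {H : Type*} [NormedAddCommGroup H] [InnerProductSpace ℂ H]

/-! ### Resolvents and spectra -/

/-- The resolvent identity. -/
theorem IsResolventAt.sub_eq {A : H →ₗ.[ℂ] H} {z w : ℂ} {R S : H →L[ℂ] H}
    (hR : IsResolventAt A z R) (hS : IsResolventAt A w S) : R - S = (z - w) • (R * S) := by
  ext f
  obtain ⟨u, hu, hu'⟩ := hS.1 f
  have h := hR.2 u
  have h1 : A u - z • (u : H) = f - (z - w) • S f := by
    rw [← hu, ← hu', sub_smul]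
    abel
  rw [h1, map_sub, map_smul, hu] at h
  simp only [_root_.sub_apply, _root_.smul_apply,
    mul_apply_eq_comp]
  rw [sub_eq_iff_eq_add] at h ⊢
  rw [h, add_comm]

/-- If one resolvent is compact, then all of them are. -/
theorem IsResolventAt.isCompactOperator {A : H →ₗ.[ℂ] H} {z w : ℂ} {R S : H →L[ℂ] H}
    (hR : IsResolventAt A z R) (hS : IsResolventAt A w S) (h : IsCompactOperator R) :
    IsCompactOperator S := by
  have h1 : S = R - (z - w) • (R * S) := by rw [← hR.sub_eq hS, sub_sub_cancel]
  rw [h1]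
  exact h.sub ((h.comp_clm S).smul (z - w))

/-- The positive spectrum of the resolvent at `-1` is transported to the spectrum of `A`. -/
theorem IsResolventAt.inv_sub_one_mem_spectrum {A : H →ₗ.[ℂ] H} {R : H →L[ℂ] H}
    (hR : IsResolventAt A (-1) R) {s : ℝ} (hs : 0 < s) (h : s ∈ _root_.spectrum ℝ R) :
    ((s⁻¹ - 1 : ℝ) : ℂ) ∈ spectrum A := by
  rintro ⟨S, hS⟩
  refine h ?_
  have hs0 : (s : ℂ) ≠ 0 := by exact_mod_cast hs.ne'
  have e : algebraMap ℝ (H →L[ℂ] H) s = (s : ℂ) • 1 := by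
    rw [Algebra.algebraMap_eq_smul_one]
    ext f
    simp
  set c : ℂ := (s : ℂ)⁻¹ with hc
  have hsc : (s : ℂ) * c = 1 := mul_inv_cancel₀ hs0
  have hz : ((s⁻¹ - 1 : ℝ) : ℂ) = c - 1 := by push_cast; rfl
  rw [hz] at hS
  have h1 : c • (R * S) = S - R := by
    rw [← neg_sub R S, hR.sub_eq hS, ← neg_smul]
    congr 1
    ring
  have h2 : c • (S * R) = S - R := by
    rw [hS.sub_eq hR]
    congr 1
    ring
  refine _root_.spectrum.mem_resolventSet_iff.2 ?_
  rw [e]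
  -- Formally `s - R = s (A - (c - 1)) (A + 1)⁻¹`, whose inverse is `c (A + 1) S = c + c² S`.
  refine ⟨⟨(s : ℂ) • 1 - R, c • 1 + c • c • S, ?_, ?_⟩, rfl⟩
  · have h3 : R * (c • c • S) = c • (S - R) := by rw [mul_smul_comm, mul_smul_comm, h1]
    have h4 : R * (c • 1) = c • R := by rw [mul_smul_comm, mul_one]
    rw [sub_mul, smul_mul_assoc, one_mul, mul_add, h3, h4, smul_add, smul_smul, hsc, one_smul,
      smul_smul, hsc, one_smul, smul_sub]
    abel
  · have h3 : (c • c • S) * R = c • (S - R) := by rw [smul_mul_assoc, smul_mul_assoc, h2]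
    have h4 : (c • 1) * R = c • R := by rw [smul_mul_assoc, one_mul]
    rw [mul_sub, mul_smul_comm, mul_one, add_mul, h3, h4, smul_add, smul_smul, hsc, one_smul,
      smul_smul, hsc, one_smul, smul_sub]
    abel

/-- Isolated points of the spectrum of `A` give isolated points of the spectrum of the
resolvent. -/
theorem IsResolventAt.nhdsWithin_le_pure {A : H →ₗ.[ℂ] H} {R : H →L[ℂ] H}
    (hR : IsResolventAt A (-1) R) {s : ℝ} (hs : 0 < s)
    (h : ((s⁻¹ - 1 : ℝ) : ℂ) ∈ discreteSpectrum A) :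
    nhdsWithin s (_root_.spectrum ℝ R) ≤ pure s := by
  obtain ⟨-, ⟨ε, hε, h1⟩, -⟩ := h
  have hcont : ContinuousAt (fun x : ℝ => ((x⁻¹ - 1 : ℝ) : ℂ)) s :=
    Complex.continuous_ofReal.continuousAt.comp ((continuousAt_inv₀ hs.ne').sub continuousAt_const)
  -- Near `s > 0`, spectral points `x` of `R` map into the spectrum of `A` close to the isolated
  -- point `1/s - 1`, and `x ↦ 1/x - 1` is injective.
  have h2 : ∀ᶠ x in nhdsWithin s (_root_.spectrum ℝ R), x = s := by
    filter_upwards [nhdsWithin_le_nhds (hcont.eventually (Metric.ball_mem_nhds _ hε)),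
      nhdsWithin_le_nhds (lt_mem_nhds hs), self_mem_nhdsWithin] with x hx hx0 hxs
    have h3 := h1 _ (hR.inv_sub_one_mem_spectrum hx0 hxs) hx
    have h4 : x⁻¹ - 1 = s⁻¹ - 1 := by exact_mod_cast h3
    exact inv_injective (by linarith)
  exact Filter.le_pure_iff.2 h2

/-- The eigenspaces of the resolvent have the dimension of the eigenspaces of `A`. -/
theorem IsResolventAt.finiteDimensional_ker {A : H →ₗ.[ℂ] H} {R : H →L[ℂ] H}
    (hR : IsResolventAt A (-1) R) {s : ℝ} (hs : 0 < s)
    (h : ((s⁻¹ - 1 : ℝ) : ℂ) ∈ discreteSpectrum A) :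
    FiniteDimensional ℂ (LinearMap.ker ((R : H →ₗ[ℂ] H) - (s : ℂ) • LinearMap.id)) := by
  obtain ⟨-, -, -, hfin⟩ := h
  set E := eigenspace A ((s⁻¹ - 1 : ℝ) : ℂ)
  have hfin' : FiniteDimensional ℂ (E.map A.domain.subtype) := inferInstance
  refine Submodule.finiteDimensional_of_le (S₂ := E.map A.domain.subtype) fun w hw => ?_
  have hs0 : (s : ℂ) ≠ 0 := by exact_mod_cast hs.ne'
  have hw' : R w = (s : ℂ) • w := by simpa [sub_eq_zero] using hw
  obtain ⟨u, hu, hu'⟩ := hR.1 w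
  -- From `u = R w = s w` and `(A + 1) u = w` follows `A u = (1/s - 1) u`.
  have hmem : u ∈ E := by
    refine LinearMap.mem_ker.2 ?_
    change A u - ((s⁻¹ - 1 : ℝ) : ℂ) • (u : H) = 0
    rw [sub_eq_zero, eq_comm, Complex.ofReal_sub, sub_smul, hu, hw', smul_smul,
      Complex.ofReal_inv, inv_mul_cancel₀ hs0, one_smul, Complex.ofReal_one, one_smul, ← hw', ← hu]
    nth_rewrite 1 [← hu']
    simp
  refine ⟨(s : ℂ)⁻¹ • u, E.smul_mem _ hmem, ?_⟩
  rw [Submodule.subtype_apply, Submodule.coe_smul, hu, hw', smul_smul, inv_mul_cancel₀ hs0,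
    one_smul]

end Resolvent

/-! ### Spectral calculus for the bounded resolvent -/

variable {H : Type*} [NormedAddCommGroup H] [InnerProductSpace ℂ H] [CompleteSpace H]

/-- If a self-adjoint `R` has only finitely many spectral points `≥ c`, all of them isolated, then
there are maps onto their eigenspaces such that `R ≤ c` on the intersection of the kernels. -/
theorem exists_spectral_projections {R : H →L[ℂ] H} (hR : IsSelfAdjoint R) {c : ℝ} (hc : 0 ≤ c)
    (F : Finset ℝ) (hF : ∀ s, s ∈ _root_.spectrum ℝ R → c ≤ s → s ∈ F)
    (hiso : ∀ s ∈ F, nhdsWithin s (_root_.spectrum ℝ R) ≤ pure s) :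
    ∃ P : ℝ → H →L[ℂ] H, (∀ s ∈ F, R * P s = (s : ℂ) • P s) ∧
      ∀ v, (∀ s ∈ F, P s v = 0) → (inner ℂ (R v) v).re ≤ c * ‖v‖ ^ 2 := by
  classical
  -- The indicator of an isolated point is continuous on the spectrum, so the continuous functional
  -- calculus already yields the spectral projection.
  set g : ℝ → ℝ → ℝ := fun s x => if x = s then 1 else 0 with hg
  have hcont : ∀ s ∈ F, ContinuousOn (g s) (_root_.spectrum ℝ R) := by
    intro s hs x hx
    by_cases hxs : x = s
    · subst hxs
      exact (tendsto_pure_nhds (g x) x).mono_left (hiso x hs)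
    · refine ContinuousAt.continuousWithinAt ?_
      refine continuousAt_const.congr (f := fun _ => (0 : ℝ)) ?_
      filter_upwards [isOpen_ne.mem_nhds hxs] with y hy
      simp [hg, hy]
  refine ⟨fun s => cfc (g s) R, fun s hs => ?_, fun v hv => ?_⟩
  · have h1 := hcont s hs
    have h2 : cfc (fun x => x * g s x) R = R * cfc (g s) R := by
      rw [cfc_mul (fun x => x) (g s) R, cfc_id' ℝ R]
    have h3 : cfc (fun x => s * g s x) R = s • cfc (g s) R := cfc_const_mul s (g s) R
    rw [← h2, Complex.coe_smul, ← h3]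
    congr 1
    ext x
    by_cases hx : x = s <;> simp [hg, hx]
  -- `f` is the identity with its values on `F` replaced by `0`. It is `≤ c` on the spectrum: points
  -- of `F` go to `0 ≤ c`, the others are `< c` already. On the common kernel, `f(R)` agrees with
  -- `R`.
  · set f : ℝ → ℝ := fun x => x - (∑ s ∈ F, fun y => s * g s y) x with hf
    have hcont' : ∀ s ∈ F, ContinuousOn (fun y => s * g s y) (_root_.spectrum ℝ R) := fun s hs =>
      continuousOn_const.mul (hcont s hs)
    have hsum : ContinuousOn (∑ s ∈ F, fun y => s * g s y) (_root_.spectrum ℝ R) := by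
      convert continuousOn_finsetSum F hcont' using 1
      ext x
      simp
    have h1 : cfc f R = R - ∑ s ∈ F, s • cfc (g s) R := by
      rw [hf, cfc_sub (fun x => x) _ R, cfc_id' ℝ R, cfc_sum _ R F hcont']
      congr 1
      exact Finset.sum_congr rfl fun s hs => cfc_const_mul s (g s) R (hcont s hs)
    have h2 : cfc f R ≤ algebraMap ℝ (H →L[ℂ] H) c := by
      refine cfc_le_algebraMap f c R (fun x hx => ?_) (continuousOn_id.sub hsum)
      have h3 : f x = x - if x ∈ F then x else 0 := by
        simp [hf, hg]
      rw [h3]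
      split_ifs with hxF
      · simpa using hc
      · rw [sub_zero]
        by_contra! hlt
        exact hxF (hF x hx hlt.le)
    have h4 : cfc f R v = R v := by
      rw [h1, _root_.sub_apply, _root_.sum_apply,
        Finset.sum_eq_zero fun s hs => ?_, sub_zero]
      rw [_root_.smul_apply, hv s hs, smul_zero]
    have h5 := ((ContinuousLinearMap.le_def _ _).1 h2).re_inner_nonneg_left v
    rw [_root_.sub_apply, h4, inner_sub_left, Algebra.algebraMap_eq_smul_one,
      _root_.smul_apply, one_apply_eq_self, map_sub,
      RCLike.re_to_complex, RCLike.re_to_complex, ← Complex.coe_smul, inner_smul_left,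
      Complex.conj_ofReal, Complex.re_ofReal_mul] at h5
    have h6 : (inner ℂ v v).re = ‖v‖ ^ 2 := inner_self_eq_norm_sq (𝕜 := ℂ) v
    rw [h6] at h5
    linarith

end UnboundedOperator

namespace UnboundedOperator

variable {H : Type*} [NormedAddCommGroup H] [InnerProductSpace ℂ H]

/-! ### Form bounds and the spectrum of the Friedrichs extension -/

/-- A family of nonzero vectors in the domain of `T` that are pairwise orthogonal, both in the
Hilbert space and for the form of `T`, with Rayleigh quotients at most `μ`. -/
structure IsDecoupledFamily {ι : Type*} (T : H →ₗ.[ℂ] H) (μ : ℝ) (u : ι → T.domain) : Prop where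
  ne_zero : ∀ i, (u i : H) ≠ 0
  inner_eq_zero : ∀ i j, i ≠ j → inner ℂ (u i : H) (u j : H) = 0
  inner_map_eq_zero : ∀ i j, i ≠ j → inner ℂ (u i : H) (T (u j)) = 0
  quadForm_le : ∀ i, quadForm T (u i) ≤ μ * ‖(u i : H)‖ ^ 2

theorem re_conj_mul_mul_self (c z : ℂ) : (c * (conj c * z)).re = ‖c‖ ^ 2 * z.re := by
  rw [← mul_assoc, Complex.mul_conj, Complex.re_ofReal_mul,
    Complex.normSq_eq_norm_sq]

namespace IsDecoupledFamily

variable {T : H →ₗ.[ℂ] H} {μ : ℝ}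

theorem norm_sq_sum {ι : Type*} [Fintype ι] {u : ι → T.domain} (hu : IsDecoupledFamily T μ u)
    (c : ι → ℂ) :
    ‖((∑ i, c i • u i : T.domain) : H)‖ ^ 2 = ∑ i, ‖c i‖ ^ 2 * ‖(u i : H)‖ ^ 2 := by
  classical
  have h : ‖((∑ i, c i • u i : T.domain) : H)‖ ^ 2 =
      (inner ℂ ((∑ i, c i • u i : T.domain) : H) ((∑ i, c i • u i : T.domain) : H)).re :=
    (inner_self_eq_norm_sq (𝕜 := ℂ) _).symm
  rw [h]
  simp only [Submodule.coe_sum, Submodule.coe_smul, sum_inner, inner_sum, inner_smul_left,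
    inner_smul_right, Complex.re_sum]
  refine Finset.sum_congr rfl fun i _ => ?_
  rw [Finset.sum_eq_single i (fun j _ hj => by simp [hu.inner_eq_zero j i hj]) (by simp),
    re_conj_mul_mul_self]
  congr 1
  exact inner_self_eq_norm_sq (𝕜 := ℂ) _

theorem quadForm_sum {ι : Type*} [Fintype ι] {u : ι → T.domain} (hu : IsDecoupledFamily T μ u)
    (c : ι → ℂ) : quadForm T (∑ i, c i • u i) = ∑ i, ‖c i‖ ^ 2 * quadForm T (u i) := by
  classical
  have h : T (∑ i, c i • u i) = ∑ i, c i • T (u i) := by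
    change T.toFun _ = _
    rw [map_sum]
    exact Finset.sum_congr rfl fun i _ => T.map_smul _ _
  rw [quadForm, h]
  simp only [Submodule.coe_sum, Submodule.coe_smul, sum_inner, inner_sum, inner_smul_left,
    inner_smul_right, Complex.re_sum]
  refine Finset.sum_congr rfl fun i _ => ?_
  rw [Finset.sum_eq_single i (fun j _ hj => by simp [hu.inner_map_eq_zero j i hj]) (by simp),
    re_conj_mul_mul_self, quadForm]

/-- A linear map with finite dimensional values vanishes on a nonzero combination of a decoupled
sequence; the bound for the form persists. -/
theorem exists_mem_ker {u : ℕ → T.domain} (hu : IsDecoupledFamily T μ u) {W : Type*}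
    [AddCommGroup W] [Module ℂ W] [FiniteDimensional ℂ W] (L : T.domain →ₗ[ℂ] W) :
    ∃ v : T.domain, (v : H) ≠ 0 ∧ L v = 0 ∧ quadForm T v ≤ μ * ‖(v : H)‖ ^ 2 := by
  -- One vector more than the dimension of `W` forces a nontrivial coefficient vector in the kernel;
  -- orthogonality then keeps the combination itself nonzero.
  set n := Module.finrank ℂ W + 1
  have hu' : IsDecoupledFamily T μ fun i : Fin n => u i :=
    ⟨fun i => hu.1 i, fun i j hij => hu.2 i j (Fin.val_ne_of_ne hij),
      fun i j hij => hu.3 i j (Fin.val_ne_of_ne hij), fun i => hu.4 i⟩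
  set f : (Fin n → ℂ) →ₗ[ℂ] T.domain := Fintype.linearCombination ℂ fun i : Fin n => u i
  have hker : LinearMap.ker (L ∘ₗ f) ≠ ⊥ :=
    LinearMap.ker_ne_bot_of_finrank_lt (by simp [n])
  obtain ⟨c, hc, hc0⟩ := (Submodule.ne_bot_iff _).1 hker
  have hfc : f c = ∑ i, c i • u i := Fintype.linearCombination_apply ℂ _ c
  have hnorm := hu'.norm_sq_sum c
  have hquad := hu'.quadForm_sum c
  refine ⟨f c, ?_, hc, ?_⟩
  · intro h0
    rw [← hfc, h0, norm_zero, zero_pow two_ne_zero, eq_comm,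
      Finset.sum_eq_zero_iff_of_nonneg fun i _ => by positivity] at hnorm
    refine hc0 (funext fun i => ?_)
    have h1 := hnorm i (Finset.mem_univ i)
    simpa [hu'.ne_zero i] using h1
  · rw [hfc, hquad, hnorm, Finset.mul_sum]
    refine Finset.sum_le_sum fun i _ => ?_
    rw [mul_left_comm]
    exact mul_le_mul_of_nonneg_left (hu'.quadForm_le i) (sq_nonneg _)

end IsDecoupledFamily

/-- The Rayleigh quotient of the resolvent is bounded below by that of the form. -/
theorem norm_sq_le_resolvent {T : H →ₗ.[ℂ] H} (hT : IsNonnegSymmetric T) {R : H →L[ℂ] H}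
    (hR : ∀ u : T.domain,
      ‖(u : H)‖ ^ 4 ≤ (inner ℂ (R u) (u : H)).re * (quadForm T u + ‖(u : H)‖ ^ 2))
    {μ : ℝ} {v : T.domain} (hv : (v : H) ≠ 0) (hq : quadForm T v ≤ μ * ‖(v : H)‖ ^ 2) :
    0 ≤ μ ∧ (1 + μ)⁻¹ * ‖(v : H)‖ ^ 2 ≤ (inner ℂ (R v) (v : H)).re := by
  have hpos : 0 < ‖(v : H)‖ ^ 2 := by positivity
  have hq0 : 0 ≤ quadForm T v := hT.nonneg v
  have hμ : 0 ≤ μ := nonneg_of_mul_nonneg_left (hq0.trans hq) hpos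
  have h1 := hR v
  set r := (inner ℂ (R v) (v : H)).re
  have hr : 0 < r := by
    refine pos_of_mul_pos_left (lt_of_lt_of_le ?_ h1) (by positivity)
    positivity
  -- Cancel `‖v‖²` in `‖v‖⁴ ≤ r (q(v) + ‖v‖²) ≤ r (1 + μ) ‖v‖²`.
  have h2 : ‖(v : H)‖ ^ 2 ≤ (1 + μ) * r := by
    refine le_of_mul_le_mul_right ?_ hpos
    nlinarith [mul_le_mul_of_nonneg_left hq hr.le]
  refine ⟨hμ, ?_⟩
  rwa [inv_mul_le_iff₀ (by linarith)]

/-! ### Spectral consequences of Rayleigh quotient bounds -/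

variable [CompleteSpace H] (T : H →ₗ.[ℂ] H) (hT : IsNonnegSymmetric T)

/-- If a vector has Rayleigh quotient `≤ μ < l`, then the Friedrichs extension has spectrum
in `(-∞, l]`. -/
theorem exists_mem_spectrum_friedrichs {μ l : ℝ} (hl : μ < l) {v : T.domain} (hv : (v : H) ≠ 0)
    (hq : quadForm T v ≤ μ * ‖(v : H)‖ ^ 2) :
    ∃ t : ℝ, t ≤ l ∧ (t : ℂ) ∈ spectrum (friedrichs T hT) := by
  obtain ⟨R, hR, hRsa, hRv⟩ := exists_resolvent_friedrichs T hT
  obtain ⟨hμ, h1⟩ := norm_sq_le_resolvent hT hRv hv hq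
  have hc : 0 < (1 + l)⁻¹ := inv_pos.2 (by linarith)
  by_contra! hne
  -- A spectral point `s ≥ 1 / (1 + l)` of `R` would give the point `1/s - 1 ≤ l` of the spectrum of
  -- `A`. With none, `R ≤ 1 / (1 + l)`, against `⟨R v, v⟩ ≥ ‖v‖² / (1 + μ)`; here `μ < l` must be
  -- strict.
  obtain ⟨P, -, hP⟩ := exists_spectral_projections hRsa hc.le ∅ (fun s hs hcs => by
    have hs0 : 0 < s := hc.trans_le hcs
    refine absurd (hR.inv_sub_one_mem_spectrum hs0 hs) (hne _ ?_)
    have := inv_le_of_inv_le₀ (by linarith) hcs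
    linarith) (by simp)
  have h2 := hP v (by simp)
  have h3 : (1 + l)⁻¹ < (1 + μ)⁻¹ := inv_strictAnti₀ (by linarith) (by linarith)
  have h4 : 0 < ‖(v : H)‖ ^ 2 := by positivity
  nlinarith

/-- If a decoupled sequence has Rayleigh quotients `≤ μ < l`, then the Friedrichs extension has
essential spectrum in `(-∞, l]`. -/
theorem exists_mem_essentialSpectrum_friedrichs {μ l : ℝ} (hl : μ < l) {u : ℕ → T.domain}
    (hu : IsDecoupledFamily T μ u) :
    ∃ t : ℝ, t ≤ l ∧ (t : ℂ) ∈ essentialSpectrum (friedrichs T hT) := by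
  obtain ⟨R, hR, hRsa, hRv⟩ := exists_resolvent_friedrichs T hT
  obtain ⟨hμ, -⟩ := norm_sq_le_resolvent hT hRv (hu.ne_zero 0) (hu.quadForm_le 0)
  set c := (1 + l)⁻¹ with hcdef
  have hc : 0 < c := inv_pos.2 (by linarith)
  by_contra! hne
  have hdisc : ∀ s ∈ _root_.spectrum ℝ R ∩ Set.Ici c,
      0 < s ∧ ((s⁻¹ - 1 : ℝ) : ℂ) ∈ discreteSpectrum (friedrichs T hT) := by
    rintro s ⟨hs, hcs⟩
    have hs0 : 0 < s := hc.trans_le hcs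
    refine ⟨hs0, ?_⟩
    by_contra hnd
    refine hne (s⁻¹ - 1) ?_ ⟨hR.inv_sub_one_mem_spectrum hs0 hs, hnd⟩
    have := inv_le_of_inv_le₀ (by linarith) (hcdef ▸ Set.mem_Ici.1 hcs)
    linarith
  have hiso : ∀ s ∈ _root_.spectrum ℝ R ∩ Set.Ici c,
      nhdsWithin s (_root_.spectrum ℝ R) ≤ pure s := fun s hs =>
    hR.nhdsWithin_le_pure (hdisc s hs).1 (hdisc s hs).2
  -- A compact set all of whose points are isolated is finite.
  have hfin : (_root_.spectrum ℝ R ∩ Set.Ici c).Finite :=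
    ((_root_.spectrum.isCompact R).inter_right isClosed_Ici).finite
      (IsDiscrete.of_nhdsWithin fun s hs =>
        (nhdsWithin_mono s Set.inter_subset_left).trans (hiso s hs))
  set F := hfin.toFinset
  have hF : ∀ s ∈ F, s ∈ _root_.spectrum ℝ R ∩ Set.Ici c := fun s hs => hfin.mem_toFinset.1 hs
  obtain ⟨P, hP, hP'⟩ := exists_spectral_projections hRsa hc.le F
    (fun s hs hcs => hfin.mem_toFinset.2 ⟨hs, hcs⟩) fun s hs => hiso s (hF s hs)
  have hker : ∀ s : F, FiniteDimensional ℂ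
      (LinearMap.ker ((R : H →ₗ[ℂ] H) - ((s : ℝ) : ℂ) • LinearMap.id)) := fun s =>
    hR.finiteDimensional_ker (hdisc s (hF s s.2)).1 (hdisc s (hF s s.2)).2
  -- Each `P s` takes values in a finite-dimensional eigenspace of `R`, so some combination `v` of
  -- the test vectors is killed by all of them.
  obtain ⟨v, hv, hLv, hq⟩ := hu.exists_mem_ker (LinearMap.pi fun s : F =>
    ((P s : H →ₗ[ℂ] H).codRestrict
      (LinearMap.ker ((R : H →ₗ[ℂ] H) - ((s : ℝ) : ℂ) • LinearMap.id)) fun w => by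
        have h := congrArg (fun S : H →L[ℂ] H => S w) (hP s s.2)
        simpa [sub_eq_zero] using h) ∘ₗ T.domain.subtype)
  obtain ⟨-, h1⟩ := norm_sq_le_resolvent hT hRv hv hq
  have h2 := hP' v fun s hs => congrArg Subtype.val (congrFun hLv ⟨s, hs⟩)
  have h3 : c < (1 + μ)⁻¹ := inv_strictAnti₀ (by linarith) (by linarith)
  have h4 : 0 < ‖(v : H)‖ ^ 2 := by positivity
  nlinarith

/-- If there is a decoupled sequence with bounded Rayleigh quotients, then the Friedrichs extension
does not have compact resolvent. -/
theorem not_hasCompactResolvent_friedrichs {μ : ℝ} {u : ℕ → T.domain}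
    (hu : IsDecoupledFamily T μ u) : ¬ HasCompactResolvent (friedrichs T hT) := by
  rintro ⟨z, S, hS, hSc⟩
  obtain ⟨R, hR, -, hRv⟩ := exists_resolvent_friedrichs T hT
  have hRc : IsCompactOperator R := hS.isCompactOperator hR hSc
  set e : ℕ → H := fun n => ((‖(u n : H)‖⁻¹ : ℝ) : ℂ) • (u n : H) with he
  have hn0 : ∀ n, ‖(u n : H)‖ ≠ 0 := fun n => norm_ne_zero_iff.2 (hu.ne_zero n)
  have hnorm : ∀ n, ‖e n‖ = 1 := fun n => by
    simp [he, norm_smul, hn0 n]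
  have hortho : Orthonormal ℂ e := ⟨hnorm, fun i j hij => by
    simp [he, inner_smul_left, inner_smul_right, hu.inner_eq_zero i j hij]⟩
  have hlow : ∀ n, (1 + μ)⁻¹ ≤ (inner ℂ (R (e n)) (e n)).re := fun n => by
    obtain ⟨-, h⟩ := norm_sq_le_resolvent hT hRv (hu.ne_zero n) (hu.quadForm_le n)
    have h1 : (inner ℂ (R (e n)) (e n)).re =
        (‖(u n : H)‖ ^ 2)⁻¹ * (inner ℂ (R (u n)) (u n : H)).re := by
      simp only [he, map_smul, inner_smul_left, inner_smul_right, Complex.conj_ofReal,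
        Complex.re_ofReal_mul]
      rw [← mul_assoc, ← mul_inv, sq]
    rw [h1, ← div_eq_inv_mul, le_div_iff₀ (pow_pos (norm_pos_iff.2 (hu.ne_zero n)) 2)]
    exact h
  obtain ⟨hμ, -⟩ := norm_sq_le_resolvent hT hRv (hu.ne_zero 0) (hu.quadForm_le 0)
  obtain ⟨w, -, φ, hφ, hlim⟩ := (hRc.isCompact_closure_image_closedBall 1).tendsto_subseq
    (x := fun n => R (e n)) fun n => subset_closure ⟨e n, by simp [hnorm n], rfl⟩
  have h1 : Filter.Tendsto (fun n => ‖R (e (φ n)) - w‖) Filter.atTop (nhds 0) :=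
    tendsto_iff_norm_sub_tendsto_zero.1 hlim
  -- Bessel's inequality: an orthonormal sequence tends weakly to `0`. Together with the strong
  -- limit `w` of `R (e (φ n))`, this sends the diagonal entries to `0`.
  have h2 : Filter.Tendsto (fun n => ‖inner ℂ (e (φ n)) w‖ ^ 2) Filter.atTop (nhds 0) :=
    (hortho.inner_products_summable w).tendsto_atTop_zero.comp hφ.tendsto_atTop
  have h3 : Filter.Tendsto (fun n => ‖inner ℂ (e (φ n)) w‖) Filter.atTop (nhds 0) := by
    have h := h2.sqrt
    simpa [Real.sqrt_sq (norm_nonneg _)] using h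
  have h4 := h1.add h3
  rw [add_zero] at h4
  have h5 : (1 + μ)⁻¹ ≤ 0 := ge_of_tendsto' h4 fun n => by
    refine (hlow (φ n)).trans ((Complex.re_le_norm _).trans ?_)
    have h6 : inner ℂ (R (e (φ n))) (e (φ n)) =
        inner ℂ (R (e (φ n)) - w) (e (φ n)) + inner ℂ w (e (φ n)) := by
      rw [inner_sub_left, sub_add_cancel]
    rw [h6]
    refine (norm_add_le _ _).trans (add_le_add ?_ (norm_inner_symm _ _).le)
    exact (norm_inner_le_norm _ _).trans_eq (by rw [hnorm, mul_one])
  exact absurd (inv_pos.2 (show 0 < 1 + μ by linarith)) h5.not_gt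

end UnboundedOperator

namespace WeightedGraph

variable {V : Type*} (G : WeightedGraph V)

/-! ### Edge forms -/

open scoped Classical in
theorem edgeForm_apply (a b : V) (hab : G.E a b ≠ 0) (x y : V) :
    (G.edgeForm a b hab : G.L2Anti) x y =
      (if (x, y) = (a, b) then 1 else 0) - (if (x, y) = (b, a) then 1 else 0) := rfl

theorem ne_of_edge {a b : V} (hab : G.E a b ≠ 0) : a ≠ b := by
  rintro rfl
  exact hab (G.no_loop a)

theorem edgeForm_apply_self {a b : V} (hab : G.E a b ≠ 0) :
    (G.edgeForm a b hab : G.L2Anti) a b = 1 := by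
  simp [edgeForm_apply, G.ne_of_edge hab]

theorem edgeForm_apply_swap {a b : V} (hab : G.E a b ≠ 0) :
    (G.edgeForm a b hab : G.L2Anti) b a = -1 := by
  rw [L2Anti.antisymm, edgeForm_apply_self]

theorem edgeForm_eq_zero {a b : V} (hab : G.E a b ≠ 0) {x y : V} (h1 : (x, y) ≠ (a, b))
    (h2 : (x, y) ≠ (b, a)) : (G.edgeForm a b hab : G.L2Anti) x y = 0 := by
  rw [edgeForm_apply, if_neg h1, if_neg h2, sub_zero]

theorem dStar_edgeForm_eq_zero {a b : V} (hab : G.E a b ≠ 0) {x : V} (ha : x ≠ a) (hb : x ≠ b) :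
    G.dStar (G.edgeForm a b hab : G.L2Anti) x = 0 :=
  G.dStar_eq_zero _ fun y => G.edgeForm_eq_zero hab (by simp [hb]) (by simp [ha])

theorem dStar_edgeForm_left {a b : V} (hab : G.E a b ≠ 0) :
    G.dStar (G.edgeForm a b hab : G.L2Anti) a = -(G.E a b / G.m a : ℂ) := by
  rw [dStar, finsum_eq_single _ b fun y hy => ?_, edgeForm_apply_swap, G.E_symm b a]
  · ring
  · rw [G.edgeForm_eq_zero hab (by simp [G.ne_of_edge hab]) (by simp [hy]), mul_zero]

theorem dStar_edgeForm_right {a b : V} (hab : G.E a b ≠ 0) :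
    G.dStar (G.edgeForm a b hab : G.L2Anti) b = (G.E a b / G.m b : ℂ) := by
  rw [dStar, finsum_eq_single _ a fun y hy => ?_, edgeForm_apply_self]
  · ring
  · rw [G.edgeForm_eq_zero hab (by simp [hy]) (by simp [(G.ne_of_edge hab).symm]), mul_zero]

theorem norm_edgeForm_sq {a b : V} (hab : G.E a b ≠ 0) :
    ‖(G.edgeForm a b hab : G.L2Anti)‖ ^ 2 = G.E a b := by
  classical
  rw [L2Anti.norm_sq_eq, tsum_eq_sum (s := {(a, b), (b, a)}) fun p hp => ?_,
    Finset.sum_pair (by simp [G.ne_of_edge hab]), edgeForm_apply_self, edgeForm_apply_swap,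
    G.E_symm b a]
  · simp only [norm_one, norm_neg]
    ring
  · simp only [Finset.mem_insert, Finset.mem_singleton, not_or] at hp
    rw [G.edgeForm_eq_zero hab hp.1 hp.2]
    simp

open scoped Classical in
/-- `⟨f, Δ₁ g⟩ = ⟨d* f, d* g⟩` for an edge form `f`. -/
theorem inner_edgeForm_laplacian {a b : V} (hab : G.E a b ≠ 0) (g : G.laplacian.domain) :
    inner ℂ (G.edgeForm a b hab : G.L2Anti) (G.laplacian g) =
      ∑ x ∈ {a, b}, (G.m x : ℂ) * (conj (G.dStar (G.edgeForm a b hab : G.L2Anti) x) *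
        G.dStar (g : G.L2Anti) x) := by
  refine G.inner_eq_sum _ _ _ (G.laplacian_apply g) _ fun x y h => ?_
  by_cases h1 : (x, y) = (a, b)
  · simp [(Prod.mk.inj h1).1, (Prod.mk.inj h1).2]
  · by_cases h2 : (x, y) = (b, a)
    · simp [(Prod.mk.inj h2).1, (Prod.mk.inj h2).2]
    · exact absurd (G.edgeForm_eq_zero hab h1 h2) h

/-- Only the two endpoints contribute to `‖d* f‖²`, giving `E²/m(a) + E²/m(b)`, while `‖f‖² = E`. -/
theorem quadForm_edgeForm {a b : V} (hab : G.E a b ≠ 0) :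
    UnboundedOperator.quadForm G.laplacian (G.edgeForm a b hab) =
      G.edgePotential a b * ‖(G.edgeForm a b hab : G.L2Anti)‖ ^ 2 := by
  classical
  have h1 : inner ℂ (G.edgeForm a b hab : G.L2Anti) (G.laplacian (G.edgeForm a b hab)) =
      ((G.edgePotential a b * G.E a b : ℝ) : ℂ) := by
    have ha : (G.m a : ℂ) ≠ 0 := by exact_mod_cast (G.m_pos a).ne'
    have hb : (G.m b : ℂ) ≠ 0 := by exact_mod_cast (G.m_pos b).ne'
    refine (G.inner_edgeForm_laplacian hab (G.edgeForm a b hab)).trans ?_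
    rw [Finset.sum_pair (G.ne_of_edge hab), dStar_edgeForm_left, dStar_edgeForm_right,
      edgePotential]
    simp only [map_neg, map_div₀, Complex.conj_ofReal]
    push_cast
    field_simp
  rw [norm_edgeForm_sq]
  exact (congrArg Complex.re h1).trans (Complex.ofReal_re _)

theorem edgeForm_ne_zero {a b : V} (hab : G.E a b ≠ 0) :
    (G.edgeForm a b hab : G.L2Anti) ≠ 0 := by
  intro h
  have h1 := G.norm_edgeForm_sq hab
  rw [h, norm_zero, zero_pow two_ne_zero] at h1
  exact hab h1.symm

/-! ### Vertex-disjoint edges -/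

/-- The edges `p` and `q` have no vertex in common. -/
def VertexDisjoint (p q : V × V) : Prop :=
  p.1 ≠ q.1 ∧ p.1 ≠ q.2 ∧ p.2 ≠ q.1 ∧ p.2 ≠ q.2

theorem finite_edges_at (a : V) : {q : V × V | 0 < G.E q.1 q.2 ∧ (q.1 = a ∨ q.2 = a)}.Finite := by
  have h := (G.locally_finite a).image fun y => (a, y)
  refine (h.union (h.image Prod.swap)).subset ?_
  rintro ⟨x, y⟩ ⟨hE, rfl | rfl⟩
  · exact Or.inl ⟨y, hE, rfl⟩
  · exact Or.inr ⟨_, ⟨x, by simpa [G.E_symm y x] using hE, rfl⟩, rfl⟩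

/-- A property of edges that holds outside of every finite set of edges for some edge holds on a
sequence of pairwise vertex-disjoint edges. -/
theorem exists_vertexDisjoint_seq (Q : V → V → Prop)
    (h : ∀ K : Finset (V × V), ∃ x y, (x, y) ∉ K ∧ 0 < G.E x y ∧ Q x y) :
    ∃ f : ℕ → V × V, (∀ n, 0 < G.E (f n).1 (f n).2 ∧ Q (f n).1 (f n).2) ∧
      ∀ i j, i ≠ j → VertexDisjoint (f i) (f j) := by
  have : Std.Symm (VertexDisjoint (V := V)) :=
    ⟨fun p q h => ⟨h.1.symm, h.2.2.1.symm, h.2.1.symm, h.2.2.2.symm⟩⟩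
  obtain ⟨f, hf, hf'⟩ := exists_seq_of_forall_finset_exists'
    (fun p : V × V => 0 < G.E p.1 p.2 ∧ Q p.1 p.2) VertexDisjoint fun s _ => by
      -- The excluded set consists of all edges, in both orientations, that touch an edge already
      -- chosen.
      have hfin : (⋃ p ∈ s, ({q : V × V | 0 < G.E q.1 q.2 ∧ (q.1 = p.1 ∨ q.2 = p.1)} ∪
          {q : V × V | 0 < G.E q.1 q.2 ∧ (q.1 = p.2 ∨ q.2 = p.2)})).Finite :=
        s.finite_toSet.biUnion fun p _ => (G.finite_edges_at p.1).union (G.finite_edges_at p.2)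
      obtain ⟨x, y, hK, hE, hQ⟩ := h hfin.toFinset
      refine ⟨(x, y), ⟨hE, hQ⟩, fun p hp => ?_⟩
      simp only [Set.Finite.mem_toFinset, Set.mem_iUnion, not_exists] at hK
      have h1 := hK p hp
      simp only [Set.mem_union, Set.mem_ofPred_eq, hE, true_and, not_or] at h1
      exact ⟨Ne.symm h1.1.1, Ne.symm h1.1.2, Ne.symm h1.2.1, Ne.symm h1.2.2⟩
  exact ⟨f, hf, fun i j hij => hf' hij⟩

/-- The forms of pairwise vertex-disjoint edges are decoupled. -/
theorem isDecoupledFamily_edgeForm {μ : ℝ} {f : ℕ → V × V}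
    (hf : ∀ n, 0 < G.E (f n).1 (f n).2 ∧ G.edgePotential (f n).1 (f n).2 ≤ μ)
    (hd : ∀ i j, i ≠ j → VertexDisjoint (f i) (f j)) :
    UnboundedOperator.IsDecoupledFamily G.laplacian μ
      fun n => G.edgeForm (f n).1 (f n).2 (hf n).1.ne' where
  ne_zero n := G.edgeForm_ne_zero _
  inner_eq_zero i j hij := by
    obtain ⟨h1, h2, -, -⟩ := hd i j hij
    rw [L2Anti.inner_def, (tsum_congr fun p => ?_).trans tsum_zero, mul_zero]
    by_cases hp : p = f i
    · subst hp
      rw [G.edgeForm_eq_zero (hf j).1.ne' (fun h => h1 (congrArg Prod.fst h))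
        fun h => h2 (congrArg Prod.fst h)]
      simp
    by_cases hp' : p = (f i).swap
    · subst hp'
      rw [G.edgeForm_eq_zero (hf j).1.ne' (x := (f i).swap.1) (y := (f i).swap.2)
        (fun h => h2 (congrArg Prod.snd h)) fun h => h1 (congrArg Prod.snd h)]
      simp
    · rw [G.edgeForm_eq_zero (hf i).1.ne' hp hp']
      simp
  inner_map_eq_zero i j hij := by
    classical
    obtain ⟨h1, h2, h3, h4⟩ := hd i j hij
    refine (G.inner_edgeForm_laplacian _ _).trans (Finset.sum_eq_zero fun x hx => ?_)
    -- Distinct edges with a common vertex would interact through `d*` there; this is why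
    -- vertex-disjointness is required.
    have h0 : G.dStar (G.edgeForm (f j).1 (f j).2 (hf j).1.ne' : G.L2Anti) x = 0 := by
      rcases Finset.mem_insert.1 hx with rfl | hx
      · exact G.dStar_edgeForm_eq_zero _ h1 h2
      · rw [Finset.mem_singleton.1 hx]
        exact G.dStar_edgeForm_eq_zero _ h3 h4
    rw [h0, mul_zero, mul_zero]
  quadForm_le n := by
    refine (G.quadForm_edgeForm _).trans_le ?_
    exact mul_le_mul_of_nonneg_right (hf n).2 (sq_nonneg _)

/-! ### Edges of infinite graphs and of simple graphs -/

theorem exists_edge [Nontrivial V] (x : V) : ∃ y, 0 < G.E x y := by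
  obtain ⟨z, hz⟩ := exists_ne x
  rcases Relation.ReflTransGen.cases_head (G.connected x z) with h | ⟨y, hy, -⟩
  · exact absurd h.symm hz
  · exact ⟨y, hy⟩

theorem exists_edge_notMem [Infinite V] (K : Finset (V × V)) : ∃ x y, (x, y) ∉ K ∧ 0 < G.E x y := by
  classical
  obtain ⟨x, hx⟩ := Infinite.exists_notMem_finset (K.image Prod.fst)
  obtain ⟨y, hy⟩ := G.exists_edge x
  exact ⟨x, y, fun h => hx (Finset.mem_image_of_mem Prod.fst h), hy⟩

theorem IsSimple.edgePotential_eq {G : WeightedGraph V} (hG : G.IsSimple) {x y : V}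
    (h : 0 < G.E x y) : G.edgePotential x y = 2 := by
  rw [edgePotential, hG.1 x, hG.1 y, (hG.2 x y).resolve_left h.ne']
  norm_num

end WeightedGraph

/-! ### The bounds for the Laplacian on `1`-forms -/

theorem mainTheorem12 {V : Type*} [Countable V] [Infinite V] (G : WeightedGraph V) :
    UnboundedOperator.bottom (UnboundedOperator.spectrum G.friedrichsLaplacian) ≤
        ⨅ (x : V) (y : V) (_ : 0 < G.E x y), (G.edgePotential x y : EReal) ∧
      UnboundedOperator.bottom (UnboundedOperator.essentialSpectrum G.friedrichsLaplacian) ≤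
        ⨆ K : Finset (V × V), ⨅ (x : V) (y : V) (_ : (x, y) ∉ K ∧ 0 < G.E x y),
          (G.edgePotential x y : EReal) ∧
      (G.IsSimple → ¬ UnboundedOperator.HasCompactResolvent G.friedrichsLaplacian) := by
  refine ⟨?_, ?_, fun hG => ?_⟩
  · refine le_iInf fun x => le_iInf fun y => le_iInf fun h => ?_
    refine EReal.le_of_forall_lt_iff_le.1 fun l hl => ?_
    obtain ⟨t, htl, ht⟩ := UnboundedOperator.exists_mem_spectrum_friedrichs G.laplacian
      G.laplacian_isNonnegSymmetric (EReal.coe_lt_coe_iff.1 hl) (G.edgeForm_ne_zero h.ne')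
      (G.quadForm_edgeForm h.ne').le
    exact (iInf₂_le t ht).trans (EReal.coe_le_coe_iff.2 htl)
  · refine EReal.le_of_forall_lt_iff_le.1 fun l hl => ?_
    -- Two strict gaps are used: supremum `< μ` yields an edge with potential below `μ` outside
    -- every finite `K`, and `μ < l` is the slack in the spectral lemma.
    obtain ⟨μ, hμ, hμl⟩ := EReal.lt_iff_exists_real_btwn.1 hl
    obtain ⟨f, hf, hd⟩ := G.exists_vertexDisjoint_seq (fun x y => G.edgePotential x y ≤ μ)
      fun K => by
        have hK := (le_iSup (fun K : Finset (V × V) => ⨅ (x : V) (y : V)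
          (_ : (x, y) ∉ K ∧ 0 < G.E x y), (G.edgePotential x y : EReal)) K).trans_lt hμ
        simp only [iInf_lt_iff] at hK
        obtain ⟨x, y, ⟨hxy, hE⟩, hlt⟩ := hK
        exact ⟨x, y, hxy, hE, (EReal.coe_lt_coe_iff.1 hlt).le⟩
    obtain ⟨t, htl, ht⟩ := UnboundedOperator.exists_mem_essentialSpectrum_friedrichs G.laplacian
      G.laplacian_isNonnegSymmetric (EReal.coe_lt_coe_iff.1 hμl)
      (G.isDecoupledFamily_edgeForm hf hd)
    exact (iInf₂_le t ht).trans (EReal.coe_le_coe_iff.2 htl)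
  -- In a simple graph every edge has potential `2`, so any sequence of vertex-disjoint edges has
  -- bounded Rayleigh quotients.
  · obtain ⟨f, hf, hd⟩ := G.exists_vertexDisjoint_seq (fun x y => G.edgePotential x y ≤ 2)
      fun K => by
        obtain ⟨x, y, hK, hE⟩ := G.exists_edge_notMem K
        exact ⟨x, y, hK, hE, (hG.edgePotential_eq hE).le⟩
    exact UnboundedOperator.not_hasCompactResolvent_friedrichs G.laplacian
      G.laplacian_isNonnegSymmetric (G.isDecoupledFamily_edgeForm hf hd)
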